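/- Let $\Gamma$ be a countably infinite connected graph (loops are allowed) with symmetric weights $\mu_{x,y}=\mu_{y,x}>0$ on the edges $x\sim y$ (and $\mu_{x,y}=0$ otherwise), such that $\mu(x)=\sum_{y\sim x}\mu_{x,y}<\infty$ for every vertex $x$; put $\mu(A)=\sum_{y\in A}\mu(y)$ for $A\subset\Gamma$. Let $d$ be the graph distance, $B(x,R)=\{y: d(x,y)<R\}$ for real $R>0$, $V(x,R)=\mu(B(x,R))$ and $v(x,r,R)=V(x,R)-V(x,r)$. Let $(X_n)$ be the random walk with transition probabilities $P(x,y)=\mu_{x,y}/\mu(x)$, and let $Pf(x)=\sum_y P(x,y)f(y)$ and $\Delta=P-I$. Let $T_A=\min\{k\ge 0: X_k\notin A\}$ and $E(x,R)=\mathbb E(T_{B(x,R)}\mid X_0=x)$. For disjoint sets $A,B\subset\Gamma$ let $$\rho(A,B)=\Big(\inf\{(-\Delta f,f)_\mu : f \text{ finitely supported},\ f|_A=1,\ f|_B=0\}\Big)^{-1},\qquad (f,g)_\mu=\sum_x f(x)g(x)\mu(x),$$ and $\rho(x,r,R)=\rho(B(x,r),\Gamma\setminus B(x,R))$ for $R>r>0$.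 Suppose that the following conditions hold. - $(p_0)$: there is $p_0>0$ such that $\mu_{x,y}/\mu(x)\ge p_0$ for all $x\sim y$. - $(VD)$: there is $D_V>0$ such that $V(x,2R)\le D_V V(x,R)$ for all $x\in\Gamma$ and all real $R>0$. - $(H)$: there is $H>1$ such that for all $x\in\Gamma$, all real $R>0$ and every function $u\ge 0$, defined on $B(x,2R)$ and the neighbours of its points, with $Pu=u$ on $B(x,2R)$, one has $\max_{B(x,R)}u\le H\min_{B(x,R)}u$. - $(wTC)$: there is $C>0$ such that $E(x,R)\le C\,E(y,R)$ for all $x\in\Gamma$, all real $R>0$ and all $y\in B(x,R)$. Then there is a constant $C>1$ such that for all $x\in\Gamma$ and all real $R>\tfrac12$ $$C^{-1}\rho(x,R,2R)\,v(x,R,2R)\le E(x,2R)\le C\,\rho(x,R,2R)\,v(x,R,2R).$$ (For $0<R\le\tfrac12$ the annulus $B(x,2R)\setminus B(x,R)$ is empty and $v(x,R,2R)=0$.) -/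

import Mathlib

open MeasureTheory ProbabilityTheory
open scoped ENNReal

/-- A connected weighted graph on the vertex set `V`: symmetric nonnegative weights `μ_{x,y}`,
positive exactly on the edges `x ∼ y` (loops are allowed), with finite total weight at each vertex.
The graph is connected; loops play no role for connectedness and for the graph distance. -/
structure WeightedGraph (V : Type*) where
  weight : V → V → ℝ
  weight_symm : ∀ x y, weight x y = weight y x
  weight_nonneg : ∀ x y, 0 ≤ weight x y
  weight_summable : ∀ x, Summable (weight x)
  connected : (SimpleGraph.fromRel fun x y => 0 < weight x y).Connected

namespace WeightedGraph

noncomputable section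

variable {V : Type*} (Γ : WeightedGraph V)

/-- The underlying simple graph: `x` and `y` are adjacent iff `x ≠ y` and `0 < μ_{x,y}`. -/
def graph : SimpleGraph V := SimpleGraph.fromRel fun x y => 0 < Γ.weight x y

/-- The measure of a vertex, `μ(x) = ∑_y μ_{x,y}`. -/
def mass (x : V) : ℝ := ∑' y, Γ.weight x y

/-- The transition probabilities `P(x,y) = μ_{x,y} / μ(x)`. -/
def trans (x y : V) : ℝ := Γ.weight x y / Γ.mass x

/-- The open ball `B(x,R)` for the graph distance. -/
def ball (x : V) (R : ℝ) : Set V := {y | (Γ.graph.dist x y : ℝ) < R}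

/-- The volume `V(x,R) = μ(B(x,R))`. -/
def vol (x : V) (R : ℝ) : ℝ := ∑' y : Γ.ball x R, Γ.mass y

/-- The volume of the annulus, `v(x,r,R) = V(x,R) - V(x,r)`. -/
def annulusVol (x : V) (r R : ℝ) : ℝ := Γ.vol x R - Γ.vol x r

/-! ### The Laplace operator and the resistance -/

/-- The Markov operator `P f(x) = ∑_y P(x,y) f(y)`. -/
def markovOp (f : V → ℝ) (x : V) : ℝ := ∑' y, Γ.trans x y * f y

/-- The Laplace operator `Δ = P - I`. -/
def laplacian (f : V → ℝ) (x : V) : ℝ := Γ.markovOp f x - f x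

/-- The inner product `(f,g)_μ = ∑_x f(x) g(x) μ(x)`. -/
def innerMu (f g : V → ℝ) : ℝ := ∑' x, f x * g x * Γ.mass x

/-- The resistance between two sets: the inverse of the infimum of the energy `(-Δ f, f)_μ` over
the finitely supported `f` with `f = 1` on `A` and `f = 0` on `B`. -/
def resistance (A B : Set V) : ℝ :=
  (sInf {q : ℝ | ∃ f : V → ℝ, f.support.Finite ∧ (∀ x ∈ A, f x = 1) ∧ (∀ x ∈ B, f x = 0) ∧
    q = Γ.innerMu (-Γ.laplacian f) f})⁻¹

/-- The resistance of the annulus, `ρ(x,r,R) = ρ(B(x,r), Γ \ B(x,R))`. -/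
def annulusRes (x : V) (r R : ℝ) : ℝ := Γ.resistance (Γ.ball x r) (Γ.ball x R)ᶜ

/-! ### The random walk and the mean exit time -/

theorem mass_pos [Nontrivial V] (x : V) : 0 < Γ.mass x := by
  obtain ⟨y, hy⟩ := Γ.connected.preconnected.exists_adj_of_nontrivial x
  have h : 0 < Γ.weight x y := by
    rw [SimpleGraph.fromRel_adj] at hy
    rcases hy.2 with h | h
    · exact h
    · rwa [Γ.weight_symm]
  exact (Γ.weight_summable x).tsum_pos (Γ.weight_nonneg x) y h

theorem tsum_ofReal_trans [Nontrivial V] (x : V) :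
    ∑' y, ENNReal.ofReal (Γ.trans x y) = 1 := by
  have hx := Γ.mass_pos x
  simp only [trans]
  rw [← ENNReal.ofReal_tsum_of_nonneg
    (fun y => div_nonneg (Γ.weight_nonneg x y) hx.le) ((Γ.weight_summable x).div_const _)]
  rw [tsum_div_const, show ∑' y, Γ.weight x y = Γ.mass x from rfl, div_self hx.ne',
    ENNReal.ofReal_one]

/-- The law `P(x,·)` of one step of the walk from `x`. -/
def stepPMF [Nontrivial V] (x : V) : PMF V :=
  ⟨fun y => ENNReal.ofReal (Γ.trans x y),
    Γ.tsum_ofReal_trans x ▸ ENNReal.summable.hasSum⟩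

variable [Nontrivial V] [MeasurableSpace V] [DiscreteMeasurableSpace V]

/-- One step of the walk, as a kernel. -/
def stepKernel : Kernel V V := ⟨fun x => (Γ.stepPMF x).toMeasure, .of_discrete⟩

instance : IsMarkovKernel Γ.stepKernel :=
  ⟨fun x => inferInstanceAs (IsProbabilityMeasure (Γ.stepPMF x).toMeasure)⟩

/-- Given `(X_0, …, X_n)`, the next position `X_{n+1}` has law `P(X_n, ·)`. -/
def historyKernel (n : ℕ) : Kernel ((_ : Finset.Iic n) → V) V :=
  Γ.stepKernel.comap (fun h => h ⟨n, Finset.mem_Iic.2 le_rfl⟩) (measurable_pi_apply _)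

instance (n : ℕ) : IsMarkovKernel (Γ.historyKernel n) :=
  inferInstanceAs (IsMarkovKernel (Γ.stepKernel.comap _ _))

/-- The law of the random walk `(X_n)_{n ≥ 0}` with `X_0 = z`, a measure on the space of
trajectories `ℕ → V`. -/
def walkLaw (z : V) : Measure (ℕ → V) :=
  Kernel.traj (X := fun _ => V) Γ.historyKernel 0 (fun _ => z)

/-- The exit time `T_A = min {k : X_k ∉ A}` of a trajectory (`∞` if it never leaves `A`). -/
def exitTime (A : Set V) (ω : ℕ → V) : ℝ≥0∞ := ⨅ (k : ℕ) (_ : ω k ∉ A), (k : ℝ≥0∞)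

/-- The mean exit time `E_z(A) = 𝔼(T_A | X_0 = z)`. -/
def meanExitFrom (z : V) (A : Set V) : ℝ≥0∞ := ∫⁻ ω, exitTime A ω ∂Γ.walkLaw z

/-- The mean exit time `E(x,R) = E_x(B(x,R))`. -/
def meanExit (x : V) (R : ℝ) : ℝ≥0∞ := Γ.meanExitFrom x (Γ.ball x R)

/-- Weak time comparison: `E(x,R) ≤ C E(y,R)` for all `R > 0` and `y ∈ B(x,R)`. -/
def WeakTimeComparison : Prop :=
  ∃ C : ℝ, 0 < C ∧ ∀ (x : V) (R : ℝ), 0 < R → ∀ y ∈ Γ.ball x R,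
    Γ.meanExit x R ≤ ENNReal.ofReal C * Γ.meanExit y R

end

/-! ### Conditions on the weighted graph -/

variable {V : Type*} (Γ : WeightedGraph V)

/-- Controlled weights: `P(x,y) ≥ p₀ > 0` for all edges `x ∼ y`. -/
def ControlledWeights : Prop :=
  ∃ p₀ : ℝ, 0 < p₀ ∧ ∀ x y : V, 0 < Γ.weight x y → p₀ ≤ Γ.weight x y / Γ.mass x

/-- Volume doubling. -/
def VolumeDoubling : Prop :=
  ∃ D : ℝ, 0 < D ∧ ∀ (x : V) (R : ℝ), 0 < R → Γ.vol x (2 * R) ≤ D * Γ.vol x R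

/-- `A` together with all neighbours of its points. -/
def closedNbhd (A : Set V) : Set V := A ∪ {y | ∃ x ∈ A, 0 < Γ.weight x y}

/-- `u` is harmonic on `A`; only the values of `u` on `closedNbhd A` matter. -/
def HarmonicOn (u : V → ℝ) (A : Set V) : Prop := ∀ x ∈ A, Γ.markovOp u x = u x

/-- The elliptic Harnack inequality. -/
def EllipticHarnack : Prop :=
  ∃ H : ℝ, 1 < H ∧ ∀ (x : V) (R : ℝ), 0 < R → ∀ u : V → ℝ,
    (∀ y ∈ Γ.closedNbhd (Γ.ball x (2 * R)), 0 ≤ u y) → Γ.HarmonicOn u (Γ.ball x (2 * R)) →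
      ∀ y ∈ Γ.ball x R, ∀ z ∈ Γ.ball x R, u y ≤ H * u z

end WeightedGraph

/-! Everything is measured by one number. Let U = B(x,2R), let k be the largest integer below R, so
that B(x,R) = {d(x,·) ≤ k}, and let g be the Green kernel of U with pole x, normalised by 1/μ(x) so
that it is symmetric in pole and argument. Put a = g(y) for some y with d(x,y) = k.

The Harnack inequality makes g constant up to a factor c on that sphere (`green_le_mul_on_sphere`).
For two nearby points it applies directly in a ball missing x. For two points y, y' far apart,
symmetry moves the pole to y and then to y': a geodesic from x to one of the points stays away from
the other, and a Harnack chain runs along it. The maximum principles then give g ≥ a/c inside the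
sphere and g ≤ ca outside it.

Truncations of g estimate the energies that define the resistance, whence a/c ≤ ρ ≤ ca
(`IsGreen.resistance_mem_Icc`). On the other side, the mean exit time solves the Poisson equation
with source 1 (`meanExitFrom_eq`), so E(x,2R) = ∑ g μ over U (`IsGreen.sum_mul_mass`).

Summing over B(x,R) only gives E(x,2R) ≥ (a/c) V(x,R). For the upper bound g may be large near x,
but that part is absorbed by the exit time e'(x) from B(x,k): E(x,2R) ≤ e'(x) + ca V(x,2R). By
(wTC), e'(x) ≤ C (E(x,2R) - e'(x)), hence E(x,2R) ≤ (C+1) ca V(x,2R). Volume doubling exchanges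
V(x,R) and V(x,2R) for v(x,R,2R). -/

namespace WeightedGraph

variable {V : Type*} {Γ : WeightedGraph V}

/-! ### The graph distance -/

theorem graph_adj {x y : V} : Γ.graph.Adj x y ↔ x ≠ y ∧ 0 < Γ.weight x y := by
  simp [graph, SimpleGraph.fromRel_adj, Γ.weight_symm y x]

theorem graph_connected (Γ : WeightedGraph V) : Γ.graph.Connected := Γ.connected

theorem dist_triangle (x y z : V) :
    Γ.graph.dist x z ≤ Γ.graph.dist x y + Γ.graph.dist y z :=
  Γ.graph_connected.dist_triangle

theorem dist_le_one_of_weight_pos {x y : V} (h : 0 < Γ.weight x y) : Γ.graph.dist x y ≤ 1 := by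
  by_cases hxy : x = y
  · simp [hxy]
  · exact (SimpleGraph.dist_eq_one_iff_adj.2 (graph_adj.2 ⟨hxy, h⟩)).le

theorem dist_le_succ_of_weight_pos (x : V) {y z : V} (h : 0 < Γ.weight y z) :
    Γ.graph.dist x z ≤ Γ.graph.dist x y + 1 :=
  (dist_triangle x y z).trans (by gcongr; exact dist_le_one_of_weight_pos h)

/-- Geodesics exist. -/
theorem exists_geodesic (Γ : WeightedGraph V) (x y : V) :
    ∃ p : ℕ → V, p 0 = x ∧ p (Γ.graph.dist x y) = y ∧
      ∀ i j, i ≤ j → j ≤ Γ.graph.dist x y → Γ.graph.dist (p i) (p j) = j - i := by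
  obtain ⟨w, hw⟩ := Γ.graph_connected.exists_walk_length_eq_dist x y
  have hup : ∀ i j, i ≤ j → j ≤ Γ.graph.dist x y →
      Γ.graph.dist (w.getVert i) (w.getVert j) ≤ j - i := by
    intro i j hij
    induction j, hij using Nat.le_induction with
    | base => simp
    | succ j hij ih =>
      intro hj
      have h1 := ih (by omega)
      have h2 : Γ.graph.dist (w.getVert j) (w.getVert (j + 1)) = 1 :=
        SimpleGraph.dist_eq_one_iff_adj.2 (w.adj_getVert_succ (by omega))
      have h3 := dist_triangle (Γ := Γ) (w.getVert i) (w.getVert j) (w.getVert (j + 1))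
      omega
  refine ⟨w.getVert, w.getVert_zero, by rw [← hw]; exact w.getVert_length, ?_⟩
  intro i j hij hj
  have h1 := hup i j hij hj
  have h2 := hup 0 i (Nat.zero_le _) (hij.trans hj)
  have h3 := hup j _ hj le_rfl
  have h4 := dist_triangle (Γ := Γ) x (w.getVert i) y
  have h5 := dist_triangle (Γ := Γ) (w.getVert i) (w.getVert j) y
  rw [w.getVert_zero] at h2
  have h6 : w.getVert (Γ.graph.dist x y) = y := by rw [← hw]; exact w.getVert_length
  rw [h6] at h3
  omega

theorem trans_nonneg (x y : V) : 0 ≤ Γ.trans x y :=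
  div_nonneg (Γ.weight_nonneg x y) (tsum_nonneg (Γ.weight_nonneg x))

theorem weight_pos_of_ne_zero {x y : V} (h : Γ.weight x y ≠ 0) : 0 < Γ.weight x y :=
  lt_of_le_of_ne (Γ.weight_nonneg x y) h.symm

/-- Every vertex has only finitely many neighbours. -/
def FiniteDegree (Γ : WeightedGraph V) : Prop := ∀ x, (Function.support (Γ.weight x)).Finite

/-- A summable family has only finitely many terms that are at least `p₀`. Hence balls are finite,
and the potential theory reduces to finite-dimensional linear algebra. -/
theorem ControlledWeights.finiteDegree (hp : Γ.ControlledWeights) : Γ.FiniteDegree := by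
  obtain ⟨p, hp0, hp⟩ := hp
  intro x
  have hs : Summable fun y => Γ.weight x y / Γ.mass x := (Γ.weight_summable x).div_const _
  have h : ∀ᶠ y in Filter.cofinite, Γ.weight x y / Γ.mass x < p :=
    hs.tendsto_cofinite_zero.eventually (gt_mem_nhds hp0)
  refine Set.Finite.subset h fun y hy => ?_
  simpa using hp x y (weight_pos_of_ne_zero hy)

theorem FiniteDegree.finite_dist_le (hL : Γ.FiniteDegree) (x : V) (n : ℕ) :
    {y | Γ.graph.dist x y ≤ n}.Finite := by
  induction n with
  | zero =>
    refine (Set.finite_singleton x).subset fun y hy => ?_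
    simpa [eq_comm] using Γ.graph_connected.dist_eq_zero_iff.1 (Nat.le_zero.1 hy)
  | succ n ih =>
    refine (ih.union (ih.biUnion fun y _ => hL y)).subset fun z hz => ?_
    obtain ⟨p, h0, hd, hp⟩ := exists_geodesic Γ x z
    by_cases h : Γ.graph.dist x z ≤ n
    · exact Or.inl h
    have hz' : Γ.graph.dist x z = n + 1 := by
      simp only [Set.mem_ofPred_eq] at hz
      omega
    rw [hz'] at hd hp
    refine Or.inr (Set.mem_biUnion (x := p n) ?_ ?_)
    · simpa [h0] using (hp 0 n (by omega) (by omega)).le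
    · have := hp n (n + 1) (by omega) le_rfl
      rw [hd] at this
      exact (graph_adj.1 (SimpleGraph.dist_eq_one_iff_adj.1 (this.trans (by omega)))).2.ne'

theorem mem_ball {x y : V} {R : ℝ} : y ∈ Γ.ball x R ↔ (Γ.graph.dist x y : ℝ) < R := Iff.rfl

theorem mem_ball_iff_lt_ceil {x y : V} {R : ℝ} :
    y ∈ Γ.ball x R ↔ Γ.graph.dist x y < ⌈R⌉₊ := mem_ball.trans Nat.lt_ceil.symm

theorem FiniteDegree.finite_ball (hL : Γ.FiniteDegree) (x : V) (R : ℝ) : (Γ.ball x R).Finite :=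
  (hL.finite_dist_le x ⌈R⌉₊).subset fun _ hy => (mem_ball_iff_lt_ceil.1 hy).le

theorem FiniteDegree.exists_dist_eq [Infinite V] (hL : Γ.FiniteDegree) (x : V) (n : ℕ) :
    ∃ y, Γ.graph.dist x y = n := by
  obtain ⟨z, hz⟩ := (hL.finite_dist_le x n).infinite_compl.nonempty
  have hz' : n < Γ.graph.dist x z := by simpa using hz
  obtain ⟨p, h0, -, hp⟩ := exists_geodesic Γ x z
  exact ⟨p n, by simpa [h0] using hp 0 n (Nat.zero_le _) hz'.le⟩

/-! ### The Markov operator on graphs of finite degree -/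

theorem FiniteDegree.summable_trans_mul (hL : Γ.FiniteDegree) (f : V → ℝ) (x : V) :
    Summable fun y => Γ.trans x y * f y :=
  summable_of_hasFiniteSupport <| (hL x).subset fun y hy h => hy (by simp [trans, h])

theorem tsum_trans [Nontrivial V] (x : V) : ∑' y, Γ.trans x y = 1 := by
  simp only [trans]
  rw [tsum_div_const]
  exact div_self (Γ.mass_pos x).ne'

theorem markovOp_const [Nontrivial V] (c : ℝ) (x : V) : Γ.markovOp (fun _ => c) x = c := by
  simp [markovOp, tsum_mul_right, tsum_trans]

theorem FiniteDegree.markovOp_add (hL : Γ.FiniteDegree) (f g : V → ℝ) (x : V) :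
    Γ.markovOp (fun y => f y + g y) x = Γ.markovOp f x + Γ.markovOp g x := by
  simp only [markovOp, mul_add]
  exact (hL.summable_trans_mul f x).tsum_add (hL.summable_trans_mul g x)

theorem FiniteDegree.markovOp_sub (hL : Γ.FiniteDegree) (f g : V → ℝ) (x : V) :
    Γ.markovOp (fun y => f y - g y) x = Γ.markovOp f x - Γ.markovOp g x := by
  simp only [markovOp, mul_sub]
  exact (hL.summable_trans_mul f x).tsum_sub (hL.summable_trans_mul g x)

theorem markovOp_smul (c : ℝ) (f : V → ℝ) (x : V) :
    Γ.markovOp (fun y => c * f y) x = c * Γ.markovOp f x := by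
  simp only [markovOp, mul_left_comm _ c, tsum_mul_left]

theorem FiniteDegree.trans_mul_le_markovOp (hL : Γ.FiniteDegree) {f : V → ℝ} (hf : ∀ y, 0 ≤ f y)
    (x y : V) : Γ.trans x y * f y ≤ Γ.markovOp f x :=
  (hL.summable_trans_mul f x).le_tsum y fun z _ => mul_nonneg (trans_nonneg x z) (hf z)

/-- The maximum principle: a function that is subharmonic on a finite set is bounded there by its
values outside. -/
theorem FiniteDegree.le_of_subharmonic [Infinite V] (hL : Γ.FiniteDegree) (U : Finset V)
    {u : V → ℝ} {c : ℝ} (hsub : ∀ z ∈ U, u z ≤ Γ.markovOp u z) (hout : ∀ z ∉ U, u z ≤ c)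
    (z : V) : u z ≤ c := by
  by_contra! hz
  have hzU : z ∈ U := by
    by_contra h
    exact (hout z h).not_gt hz
  obtain ⟨w, hwU, hw⟩ := U.exists_max_image u ⟨z, hzU⟩
  have hcw : c < u w := hz.trans_le (hw z hzU)
  have hmax : ∀ y, u y ≤ u w := fun y => by
    by_cases hy : y ∈ U
    · exact hw y hy
    · exact (hout y hy).trans hcw.le
  -- A maximum attained in `U` passes to every neighbour, hence by connectedness to all of `V`,
  -- which contains points outside the finite set `U`.
  have hstep : ∀ a b, u a = u w → Γ.graph.Adj a b → u b = u w := by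
    intro a b ha hab
    have haU : a ∈ U := by
      by_contra h
      exact ((hout a h).trans_lt hcw).ne ha
    have h1 := hL.trans_mul_le_markovOp (f := fun y => u w - u y)
      (fun y => sub_nonneg.2 (hmax y)) a b
    rw [hL.markovOp_sub, markovOp_const] at h1
    have h2 := hsub a haU
    have hpos : 0 < Γ.trans a b := div_pos (graph_adj.1 hab).2 (Γ.mass_pos a)
    have h3 : Γ.trans a b * (u w - u b) ≤ 0 := by linarith
    have h4 : u w - u b ≤ 0 := nonpos_of_mul_nonpos_right h3 hpos
    exact le_antisymm (hmax b) (by linarith)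
  have hall : ∀ y, u y = u w := by
    intro y
    obtain ⟨p⟩ := Γ.graph_connected.preconnected w y
    have : ∀ a b, Γ.graph.Walk a b → u a = u w → u b = u w := by
      intro a b q
      induction q with
      | nil => exact id
      | cons h _ ih => exact fun ha => ih (hstep _ _ ha h)
    exact this w y p rfl
  obtain ⟨y, hy⟩ := Infinite.exists_notMem_finset U
  exact ((hout y hy).trans_lt hcw).ne (hall y)

/-- The minimum principle. -/
theorem FiniteDegree.le_of_superharmonic [Infinite V] (hL : Γ.FiniteDegree) (U : Finset V)
    {u : V → ℝ} {c : ℝ} (hsup : ∀ z ∈ U, Γ.markovOp u z ≤ u z) (hout : ∀ z ∉ U, c ≤ u z)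
    (z : V) : c ≤ u z := by
  have := hL.le_of_subharmonic U (u := fun z => -1 * u z) (c := -c)
    (fun z hz => by rw [markovOp_smul]; linarith [hsup z hz])
    (fun z hz => by linarith [hout z hz]) z
  linarith

/-! ### The Poisson equation on a finite set -/

/-- `u` solves `u - P u = f` on `U` and vanishes outside `U`. -/
structure IsPoisson (Γ : WeightedGraph V) (U : Finset V) (f u : V → ℝ) : Prop where
  eq_zero : ∀ z ∉ U, u z = 0
  sub_markovOp : ∀ z ∈ U, u z - Γ.markovOp u z = f z

/-- On the finite-dimensional space of functions supported in `U`, the operator `I - P` followed by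
restriction to `U` is injective by the maximum principles, hence surjective. -/
theorem FiniteDegree.exists_isPoisson [Infinite V] (hL : Γ.FiniteDegree) (U : Finset V)
    (f : V → ℝ) : ∃ u, Γ.IsPoisson U f u := by
  classical
  let ext : (U → ℝ) →ₗ[ℝ] (V → ℝ) :=
    { toFun := fun φ z => if h : z ∈ U then φ ⟨z, h⟩ else 0
      map_add' := fun φ ψ => by
        ext z
        by_cases h : z ∈ U <;> simp [h]
      map_smul' := fun c φ => by
        ext z
        by_cases h : z ∈ U <;> simp [h] }
  have hext : ∀ φ z (h : z ∈ U), ext φ z = φ ⟨z, h⟩ := fun φ z h => by simp [ext, h]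
  have hext0 : ∀ φ, ∀ z ∉ U, ext φ z = 0 := fun φ z h => by simp [ext, h]
  let T : (U → ℝ) →ₗ[ℝ] (U → ℝ) :=
    { toFun := fun φ z => φ z - Γ.markovOp (ext φ) z
      map_add' := fun φ ψ => by
        ext z
        have := hL.markovOp_add (ext φ) (ext ψ) z
        rw [map_add]
        simp only [Pi.add_apply]
        rw [show (ext φ + ext ψ) = fun y => ext φ y + ext ψ y from rfl, this]
        ring
      map_smul' := fun c φ => by
        ext z
        have := markovOp_smul (Γ := Γ) c (ext φ) z
        rw [map_smul]
        simp only [Pi.smul_apply, smul_eq_mul, RingHom.id_apply]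
        rw [show (c • ext φ) = fun y => c * ext φ y from rfl, this]
        ring }
  have hinj : Function.Injective T := by
    rw [injective_iff_map_eq_zero]
    intro φ hφ
    have h1 : ∀ z ∈ U, ext φ z = Γ.markovOp (ext φ) z := fun z hz => by
      have := congrFun hφ ⟨z, hz⟩
      simp only [T, LinearMap.coe_mk, AddHom.coe_mk, Pi.zero_apply] at this
      rw [hext φ z hz]
      linarith
    ext z
    have h2 := hL.le_of_subharmonic U (c := 0) (fun z hz => (h1 z hz).le)
      (fun z hz => (hext0 φ z hz).le) z
    have h3 := hL.le_of_superharmonic U (c := 0) (fun z hz => (h1 z hz).ge)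
      (fun z hz => (hext0 φ z hz).ge) z
    rw [hext φ z z.2] at h2 h3
    exact le_antisymm h2 h3
  obtain ⟨φ, hφ⟩ := (LinearMap.injective_iff_surjective.1 hinj) (fun z => f z)
  refine ⟨ext φ, hext0 φ, fun z hz => ?_⟩
  rw [hext φ z hz]
  exact congrFun hφ ⟨z, hz⟩

theorem IsPoisson.nonneg [Infinite V] (hL : Γ.FiniteDegree) {U : Finset V} {f u : V → ℝ}
    (h : Γ.IsPoisson U f u) (hf : ∀ z ∈ U, 0 ≤ f z) (z : V) : 0 ≤ u z :=
  hL.le_of_superharmonic U (fun z hz => by linarith [h.sub_markovOp z hz, hf z hz])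
    (fun z hz => (h.eq_zero z hz).ge) z

/-- Solutions with a nonnegative source increase with the domain. -/
theorem IsPoisson.mono [Infinite V] (hL : Γ.FiniteDegree) {U W : Finset V} {f u w : V → ℝ}
    (hu : Γ.IsPoisson U f u) (hw : Γ.IsPoisson W f w) (hUW : U ⊆ W) (hf : ∀ z ∈ W, 0 ≤ f z)
    (z : V) : u z ≤ w z := by
  have := hL.le_of_superharmonic U (u := fun z => w z - u z) (c := 0)
    (fun z hz => by
      rw [hL.markovOp_sub]
      linarith [hu.sub_markovOp z hz, hw.sub_markovOp z (hUW hz)])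
    (fun z hz => by
      rw [hu.eq_zero z hz, sub_zero]
      exact hw.nonneg hL hf z) z
  linarith

/-! ### The energy form of functions supported in a finite set -/

/-- The bilinear form `(a, b) ↦ (-Δ a, b)_μ` for functions supported in `U`. -/
noncomputable def energy (Γ : WeightedGraph V) (U : Finset V) (a b : V → ℝ) : ℝ :=
  ∑ z ∈ U, (Γ.mass z * a z - ∑ w ∈ U, Γ.weight z w * a w) * b z

theorem mass_mul_markovOp [Nontrivial V] {U : Finset V} {a : V → ℝ} (ha : ∀ z ∉ U, a z = 0)
    (z : V) : Γ.mass z * Γ.markovOp a z = ∑ w ∈ U, Γ.weight z w * a w := by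
  rw [markovOp, tsum_eq_sum (s := U) fun w hw => by simp [ha w hw], Finset.mul_sum]
  refine Finset.sum_congr rfl fun w _ => ?_
  have := (Γ.mass_pos z).ne'
  simp only [trans]
  field_simp

theorem energy_eq_sum [Nontrivial V] {U : Finset V} {a : V → ℝ} (ha : ∀ z ∉ U, a z = 0)
    (b : V → ℝ) :
    Γ.energy U a b = ∑ z ∈ U, (a z - Γ.markovOp a z) * b z * Γ.mass z := by
  refine Finset.sum_congr rfl fun z _ => ?_
  rw [← mass_mul_markovOp ha]
  ring

theorem innerMu_neg_laplacian [Nontrivial V] {U : Finset V} {a b : V → ℝ}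
    (ha : ∀ z ∉ U, a z = 0) (hb : ∀ z ∉ U, b z = 0) :
    Γ.innerMu (-Γ.laplacian a) b = Γ.energy U a b := by
  rw [innerMu, tsum_eq_sum (s := U) fun z hz => by simp [hb z hz], energy_eq_sum ha]
  exact Finset.sum_congr rfl fun z _ => by simp [laplacian]

theorem energy_comm (U : Finset V) (a b : V → ℝ) : Γ.energy U a b = Γ.energy U b a := by
  simp only [energy, sub_mul, Finset.sum_sub_distrib, Finset.sum_mul]
  congr 1
  · exact Finset.sum_congr rfl fun z _ => by ring
  · rw [Finset.sum_comm]
    refine Finset.sum_congr rfl fun z _ => Finset.sum_congr rfl fun w _ => ?_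
    rw [Γ.weight_symm]
    ring

theorem energy_sub_left (U : Finset V) (a b c : V → ℝ) :
    Γ.energy U (fun z => a z - b z) c = Γ.energy U a c - Γ.energy U b c := by
  simp only [energy, ← Finset.sum_sub_distrib]
  refine Finset.sum_congr rfl fun z _ => ?_
  simp only [mul_sub, Finset.sum_sub_distrib]
  ring

theorem energy_smul_left (U : Finset V) (t : ℝ) (a c : V → ℝ) :
    Γ.energy U (fun z => t * a z) c = t * Γ.energy U a c := by
  simp only [energy, Finset.mul_sum]
  refine Finset.sum_congr rfl fun z _ => ?_
  simp only [mul_left_comm _ t, ← Finset.mul_sum]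
  ring

/-- The energy as a sum over pairs, plus a killing term. -/
theorem two_mul_energy (U : Finset V) (a b : V → ℝ) :
    2 * Γ.energy U a b = ∑ z ∈ U, ∑ w ∈ U, Γ.weight z w * ((a z - a w) * (b z - b w)) +
      2 * ∑ z ∈ U, (Γ.mass z - ∑ w ∈ U, Γ.weight z w) * (a z * b z) := by
  have h1 : ∑ z ∈ U, ∑ w ∈ U, Γ.weight z w * (a w * b w) =
      ∑ z ∈ U, ∑ w ∈ U, Γ.weight z w * (a z * b z) := by
    rw [Finset.sum_comm]
    exact Finset.sum_congr rfl fun z _ => Finset.sum_congr rfl fun w _ => by rw [Γ.weight_symm]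
  have h2 : ∑ z ∈ U, ∑ w ∈ U, Γ.weight z w * (a z * b w) =
      ∑ z ∈ U, ∑ w ∈ U, Γ.weight z w * (a w * b z) := by
    rw [Finset.sum_comm]
    exact Finset.sum_congr rfl fun z _ => Finset.sum_congr rfl fun w _ => by rw [Γ.weight_symm]
  have h3 : ∑ z ∈ U, ∑ w ∈ U, Γ.weight z w * ((a z - a w) * (b z - b w)) =
      2 * ∑ z ∈ U, ∑ w ∈ U, Γ.weight z w * (a z * b z) -
        2 * ∑ z ∈ U, ∑ w ∈ U, Γ.weight z w * (a w * b z) := by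
    rw [two_mul, two_mul]
    nth_rw 2 [← h1]
    nth_rw 2 [← h2]
    simp only [← Finset.sum_add_distrib, ← Finset.sum_sub_distrib]
    exact Finset.sum_congr rfl fun z _ => Finset.sum_congr rfl fun w _ => by ring
  rw [h3]
  simp only [energy, sub_mul, Finset.sum_mul, Finset.sum_sub_distrib]
  have h4 : ∑ z ∈ U, Γ.mass z * a z * b z = ∑ z ∈ U, Γ.mass z * (a z * b z) :=
    Finset.sum_congr rfl fun z _ => by ring
  have h5 : ∑ z ∈ U, ∑ w ∈ U, Γ.weight z w * a w * b z =
      ∑ z ∈ U, ∑ w ∈ U, Γ.weight z w * (a w * b z) :=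
    Finset.sum_congr rfl fun z _ => Finset.sum_congr rfl fun w _ => by ring
  rw [h4, h5]
  ring

theorem sum_weight_le_mass (U : Finset V) (z : V) : ∑ w ∈ U, Γ.weight z w ≤ Γ.mass z :=
  (Γ.weight_summable z).sum_le_tsum U fun w _ => Γ.weight_nonneg z w

theorem energy_self_nonneg (U : Finset V) (a : V → ℝ) : 0 ≤ Γ.energy U a a := by
  have h := two_mul_energy (Γ := Γ) U a a
  have h1 : 0 ≤ ∑ z ∈ U, ∑ w ∈ U, Γ.weight z w * ((a z - a w) * (a z - a w)) :=
    Finset.sum_nonneg fun z _ => Finset.sum_nonneg fun w _ =>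
      mul_nonneg (Γ.weight_nonneg z w) (mul_self_nonneg _)
  have h2 : 0 ≤ ∑ z ∈ U, (Γ.mass z - ∑ w ∈ U, Γ.weight z w) * (a z * a z) :=
    Finset.sum_nonneg fun z _ =>
      mul_nonneg (sub_nonneg.2 (sum_weight_le_mass U z)) (mul_self_nonneg _)
  linarith

/-- Truncation is monotone and 1-Lipschitz; this is the term-by-term form of the energy comparison
below. -/
theorem min_sub_min_mul_self_le (a b m : ℝ) :
    (min a m - min b m) * (min a m - min b m) ≤ (a - b) * (min a m - min b m) := by
  rcases le_total a m with ha | ha <;> rcases le_total b m with hb | hb <;>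
    simp only [ha, hb, min_eq_left, min_eq_right] <;> nlinarith

/-- Truncation decreases the energy. -/
theorem energy_min_le (U : Finset V) {a : V → ℝ} (ha : ∀ z, 0 ≤ a z) {m : ℝ} (hm : 0 ≤ m) :
    Γ.energy U (fun z => min (a z) m) (fun z => min (a z) m) ≤
      Γ.energy U a (fun z => min (a z) m) := by
  have h1 := two_mul_energy (Γ := Γ) U (fun z => min (a z) m) (fun z => min (a z) m)
  have h2 := two_mul_energy (Γ := Γ) U a (fun z => min (a z) m)
  have h3 : ∑ z ∈ U, ∑ w ∈ U, Γ.weight z w *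
      ((min (a z) m - min (a w) m) * (min (a z) m - min (a w) m)) ≤
      ∑ z ∈ U, ∑ w ∈ U, Γ.weight z w * ((a z - a w) * (min (a z) m - min (a w) m)) :=
    Finset.sum_le_sum fun z _ => Finset.sum_le_sum fun w _ =>
      mul_le_mul_of_nonneg_left (min_sub_min_mul_self_le _ _ _) (Γ.weight_nonneg z w)
  have h4 : ∑ z ∈ U, (Γ.mass z - ∑ w ∈ U, Γ.weight z w) * (min (a z) m * min (a z) m) ≤
      ∑ z ∈ U, (Γ.mass z - ∑ w ∈ U, Γ.weight z w) * (a z * min (a z) m) :=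
    Finset.sum_le_sum fun z _ => mul_le_mul_of_nonneg_left
      (mul_le_mul_of_nonneg_right (min_le_left _ _) (le_min (ha z) hm))
      (sub_nonneg.2 (sum_weight_le_mass U z))
  linarith

/-! ### The Green kernel -/

open Classical in
/-- `g = g^U(x,·)` is the Green kernel of `U` with pole `x`. -/
def IsGreen (Γ : WeightedGraph V) (U : Finset V) (x : V) (g : V → ℝ) : Prop :=
  Γ.IsPoisson U (fun z => if z = x then (Γ.mass x)⁻¹ else 0) g

theorem IsGreen.markovOp_eq {U : Finset V} {x z : V} {g : V → ℝ} (hg : Γ.IsGreen U x g)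
    (hz : z ∈ U) (hzx : z ≠ x) : Γ.markovOp g z = g z := by
  have := hg.sub_markovOp z hz
  rw [if_neg hzx] at this
  linarith

theorem IsGreen.nonneg [Infinite V] (hL : Γ.FiniteDegree) {U : Finset V} {x : V} {g : V → ℝ}
    (hg : Γ.IsGreen U x g) (z : V) : 0 ≤ g z :=
  IsPoisson.nonneg hL hg (fun z _ => by
    split_ifs
    exacts [inv_nonneg.2 (Γ.mass_pos x).le, le_rfl]) z

theorem IsGreen.markovOp_le [Nontrivial V] {U : Finset V} {x z : V} {g : V → ℝ}
    (hg : Γ.IsGreen U x g) (hz : z ∈ U) : Γ.markovOp g z ≤ g z := by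
  by_cases hzx : z = x
  · subst hzx
    have := hg.sub_markovOp z hz
    rw [if_pos rfl] at this
    linarith [inv_pos.2 (Γ.mass_pos z)]
  · exact (hg.markovOp_eq hz hzx).le

/-- The reproducing property of the Green kernel. -/
theorem IsGreen.energy_eq [Nontrivial V] {U : Finset V} {x : V} {g : V → ℝ}
    (hg : Γ.IsGreen U x g) (hx : x ∈ U) (b : V → ℝ) : Γ.energy U g b = b x := by
  rw [energy_eq_sum hg.eq_zero, Finset.sum_eq_single_of_mem x hx]
  · rw [hg.sub_markovOp x hx, if_pos rfl]
    have := (Γ.mass_pos x).ne'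
    field_simp
  · intro z hz hzx
    rw [hg.sub_markovOp z hz, if_neg hzx]
    ring

theorem IsGreen.symm [Nontrivial V] {U : Finset V} {x y : V} {g h : V → ℝ}
    (hg : Γ.IsGreen U x g) (hh : Γ.IsGreen U y h) (hx : x ∈ U) (hy : y ∈ U) : g y = h x := by
  rw [← hg.energy_eq hx h, ← hh.energy_eq hy g, energy_comm]

/-- The solution of the Poisson equation with source `1` is the sum of the Green kernel. -/
theorem IsGreen.sum_mul_mass [Nontrivial V] {U : Finset V} {x : V} {g e : V → ℝ}
    (hg : Γ.IsGreen U x g) (he : Γ.IsPoisson U (fun _ => 1) e) (hx : x ∈ U) :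
    ∑ y ∈ U, g y * Γ.mass y = e x := by
  rw [← hg.energy_eq hx e, energy_comm, energy_eq_sum he.eq_zero]
  exact Finset.sum_congr rfl fun z hz => by rw [he.sub_markovOp z hz, one_mul]

/-! ### Resistance and the Green kernel -/

/-- If `g^U(x,·) ≥ m` on `A`, then the resistance between `A` and the complement of `U` is at least
`m`. -/
theorem IsGreen.le_resistance [Infinite V] (hL : Γ.FiniteDegree) {U : Finset V} {x : V} {g : V → ℝ}
    (hg : Γ.IsGreen U x g) {A : Set V} (hxA : x ∈ A) (hAU : A ⊆ U) {m : ℝ} (hm : 0 < m)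
    (hmA : ∀ z ∈ A, m ≤ g z)
    (hpos : 0 < sInf {q : ℝ | ∃ f : V → ℝ, f.support.Finite ∧ (∀ x ∈ A, f x = 1) ∧
      (∀ x ∈ (U : Set V)ᶜ, f x = 0) ∧ q = Γ.innerMu (-Γ.laplacian f) f}) :
    m ≤ Γ.resistance A (U : Set V)ᶜ := by
  -- Positivity of the infimum matters, as the inverse of `0` is `0` by convention.
  rw [resistance, le_inv_comm₀ hm hpos]
  -- The test function is `h / m`: it is `1` on `A`, and the reproducing property bounds the energy
  -- of `h` by `m`.
  set h : V → ℝ := fun z => min (g z) m with hh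
  have h0 : ∀ z ∉ U, m⁻¹ * h z = 0 := fun z hz => by simp [hh, hg.eq_zero z hz, hm.le]
  have hbdd : BddBelow {q : ℝ | ∃ f : V → ℝ, f.support.Finite ∧ (∀ x ∈ A, f x = 1) ∧
      (∀ x ∈ (U : Set V)ᶜ, f x = 0) ∧ q = Γ.innerMu (-Γ.laplacian f) f} := by
    refine ⟨0, ?_⟩
    rintro q ⟨f, -, -, hf, rfl⟩
    have hf' : ∀ z ∉ U, f z = 0 := fun z hz => hf z (by simpa using hz)
    rw [innerMu_neg_laplacian hf' hf']
    exact energy_self_nonneg U f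
  refine (csInf_le hbdd ⟨fun z => m⁻¹ * h z, ?_, ?_, ?_, rfl⟩).trans ?_
  · exact U.finite_toSet.subset fun z hz => by
      by_contra hzU
      exact hz (h0 z hzU)
  · intro z hz
    simp [hh, hmA z hz, hm.ne']
  · exact fun z hz => h0 z (by simpa using hz)
  · rw [innerMu_neg_laplacian h0 h0, energy_smul_left, energy_comm, energy_smul_left]
    have h1 := energy_min_le (Γ := Γ) U (hg.nonneg hL) hm.le
    rw [hg.energy_eq (hAU hxA), min_eq_right (hmA x hxA)] at h1
    calc m⁻¹ * (m⁻¹ * Γ.energy U h h) ≤ m⁻¹ * (m⁻¹ * m) := by gcongr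
      _ = m⁻¹ := by field_simp

/-- If `g^U(x,·) ≤ M` off the interior of `A`, then the energies defining the resistance between
`A` and the complement of `U` are at least `M⁻¹`. -/
theorem IsGreen.inv_le_innerMu [Infinite V] (hL : Γ.FiniteDegree) {U : Finset V} {x : V}
    {g : V → ℝ} (hg : Γ.IsGreen U x g) {A : Set V} (hxA : x ∈ A) (hAU : A ⊆ U) {M : ℝ}
    (hM : 0 < M) (hMA : ∀ z, M < g z → z ∈ A ∧ ∀ w, 0 < Γ.weight z w → w ∈ A) {f : V → ℝ}
    (hf1 : ∀ z ∈ A, f z = 1) (hf0 : ∀ z ∉ U, f z = 0) :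
    M⁻¹ ≤ Γ.innerMu (-Γ.laplacian f) f := by
  rw [innerMu_neg_laplacian hf0 hf0]
  set h : V → ℝ := fun z => min (g z) M with hh
  have hxU := hAU hxA
  -- Where `g` exceeds `M`, `f` equals `1` at the point and at its neighbours, so `Δ f = 0` there;
  -- elsewhere `g - h = 0`.
  have h1 : Γ.energy U f (fun z => g z - h z) = 0 := by
    rw [energy_eq_sum hf0]
    refine Finset.sum_eq_zero fun z _ => ?_
    by_cases hz : M < g z
    · have : Γ.markovOp f z = 1 := by
        rw [← markovOp_const (Γ := Γ) 1 z, markovOp, markovOp]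
        refine tsum_congr fun w => ?_
        by_cases hw : Γ.weight z w = 0
        · simp [trans, hw]
        · rw [hf1 w ((hMA z hz).2 w (weight_pos_of_ne_zero hw))]
      rw [this, hf1 z (hMA z hz).1]
      ring
    · simp [hh, not_lt.1 hz]
  have h2 : Γ.energy U h f = 1 := by
    have h3 : Γ.energy U g f = 1 := by rw [hg.energy_eq hxU, hf1 x hxA]
    rw [energy_comm, energy_sub_left, energy_comm U h, h3] at h1
    linarith [energy_comm (Γ := Γ) U h f]
  have h4 : Γ.energy U h h ≤ M := by
    refine (energy_min_le (Γ := Γ) U (hg.nonneg hL) hM.le).trans ?_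
    rw [hg.energy_eq hxU]
    exact min_le_right _ _
  -- Completing the square: the energy of `f` is at least `2/M` minus `M⁻²` times the energy of `h`,
  -- and the latter energy is at most `M`.
  have h5 := energy_self_nonneg (Γ := Γ) U (fun z => f z - M⁻¹ * h z)
  rw [energy_sub_left, energy_smul_left, energy_comm U f, energy_comm U h, energy_sub_left,
    energy_sub_left, energy_smul_left, energy_smul_left, energy_comm U f h, h2] at h5
  have h6 : M⁻¹ * (M⁻¹ * Γ.energy U h h) ≤ M⁻¹ := by
    calc _ ≤ M⁻¹ * (M⁻¹ * M) := by gcongr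
      _ = M⁻¹ := by field_simp
  nlinarith

/-- Two-sided bound of the resistance by the values of the Green kernel. -/
theorem IsGreen.resistance_mem_Icc [Infinite V] (hL : Γ.FiniteDegree) {U : Finset V} {x : V}
    {g : V → ℝ} (hg : Γ.IsGreen U x g) {A : Set V} (hxA : x ∈ A) (hAU : A ⊆ U) {m M : ℝ}
    (hm : 0 < m) (hmA : ∀ z ∈ A, m ≤ g z)
    (hM : 0 < M) (hMA : ∀ z, M < g z → z ∈ A ∧ ∀ w, 0 < Γ.weight z w → w ∈ A) :
    Γ.resistance A (U : Set V)ᶜ ∈ Set.Icc m M := by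
  classical
  have hle : M⁻¹ ≤ sInf {q : ℝ | ∃ f : V → ℝ, f.support.Finite ∧ (∀ x ∈ A, f x = 1) ∧
      (∀ x ∈ (U : Set V)ᶜ, f x = 0) ∧ q = Γ.innerMu (-Γ.laplacian f) f} := by
    refine le_csInf ⟨_, fun z => if z ∈ U then 1 else 0, ?_, ?_, ?_, rfl⟩ ?_
    · exact U.finite_toSet.subset fun z hz => by
        by_contra hzU
        exact hz (if_neg hzU)
    · exact fun z hz => if_pos (hAU hz)
    · exact fun z hz => if_neg hz
    · rintro q ⟨f, -, hf1, hf0, rfl⟩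
      exact hg.inv_le_innerMu hL hxA hAU hM hMA hf1 fun z hz => hf0 z (by simpa using hz)
  have hpos := (inv_pos.2 hM).trans_le hle
  exact ⟨hg.le_resistance hL hxA hAU hm hmA hpos, (inv_le_comm₀ hpos hM).2 hle⟩

/-! ### The mean exit time solves the Poisson equation -/

section ExitTime

/-- The trajectories that stay in `A` up to time `k`. -/
def staysUpTo (A : Set V) (k : ℕ) : Set (ℕ → V) := {ω | ∀ i ≤ k, ω i ∈ A}

/-- The exit time counts the times `k` at which the trajectory has not yet left `A`. -/
theorem exitTime_eq_tsum (A : Set V) (ω : ℕ → V) :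
    exitTime A ω = ∑' k, (staysUpTo A k).indicator (fun _ => (1 : ℝ≥0∞)) ω := by
  classical
  by_cases h : ∃ k, ω k ∉ A
  · have hmem : ∀ k, ω ∈ staysUpTo A k ↔ k < Nat.find h := fun k => by
      simp [staysUpTo, Nat.lt_find_iff]
    have h1 : ∑' k, (staysUpTo A k).indicator (fun _ => (1 : ℝ≥0∞)) ω = Nat.find h := by
      rw [tsum_eq_sum (s := Finset.range (Nat.find h)) fun k hk => by
        rw [Set.indicator_of_notMem]
        simpa [hmem] using hk]
      rw [Finset.sum_congr rfl fun k hk => by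
        rw [Set.indicator_of_mem ((hmem k).2 (Finset.mem_range.1 hk))]]
      simp
    rw [h1]
    refine le_antisymm (iInf₂_le (Nat.find h) (Nat.find_spec h)) (le_iInf₂ fun k hk => ?_)
    exact_mod_cast Nat.find_min' h hk
  · push Not at h
    have hmem : ∀ k, ω ∈ staysUpTo A k := fun k i _ => h i
    simp [exitTime, h, hmem]

variable [MeasurableSpace V] [DiscreteMeasurableSpace V]

theorem measurableSet_staysUpTo (A : Set V) (k : ℕ) : MeasurableSet (staysUpTo A k) := by
  have : staysUpTo A k = ⋂ i, ⋂ _ : i ≤ k, (fun ω : ℕ → V => ω i) ⁻¹' A := by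
    ext ω
    simp [staysUpTo]
  rw [this]
  exact .iInter fun i => .iInter fun _ => measurable_pi_apply i (.of_discrete)

variable [Nontrivial V]

theorem lintegral_stepKernel [Countable V] (x : V) (f : V → ℝ≥0∞) :
    ∫⁻ y, f y ∂Γ.stepKernel x = ∑' y, ENNReal.ofReal (Γ.trans x y) * f y := by
  rw [lintegral_countable']
  refine tsum_congr fun y => ?_
  rw [mul_comm]
  congr 1
  exact (Γ.stepPMF x).toMeasure_apply_singleton y (.singleton y)

/-- The Markov property, for functionals that depend on the past through the event of staying
in `A`. -/
theorem lintegral_staysUpTo_succ [Countable V] (A : Set V) (z : V) (k : ℕ) (f : V → ℝ≥0∞)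
    (hf : ∀ y ∉ A, f y = 0) :
    ∫⁻ ω, (staysUpTo A (k + 1)).indicator (fun ω => f (ω (k + 1))) ω ∂Γ.walkLaw z =
      ∫⁻ ω, (staysUpTo A k).indicator
        (fun ω => ∑' y, ENNReal.ofReal (Γ.trans (ω k) y) * f y) ω ∂Γ.walkLaw z := by
  have hfm : Measurable f := .of_discrete
  set ψ : V → ℝ≥0∞ := fun x => ∑' y, ENNReal.ofReal (Γ.trans x y) * f y with hψ
  have hψm : Measurable ψ := .of_discrete
  -- Since `f` vanishes off `A`, the condition at time `k + 1` is automatic, and the event depends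
  -- only on the coordinates up to `k`, on which the law is then disintegrated.
  have hind : ∀ ω : ℕ → V, (staysUpTo A (k + 1)).indicator (fun ω => f (ω (k + 1))) ω =
      (staysUpTo A k).indicator (fun ω => f (ω (k + 1))) ω := by
    intro ω
    by_cases h : ω ∈ staysUpTo A k
    · by_cases h' : ω (k + 1) ∈ A
      · have : ω ∈ staysUpTo A (k + 1) := fun i hi => by
          rcases Nat.le_succ_iff.1 hi with hi | rfl
          exacts [h i hi, h']
        simp [h, this]
      · have : ω ∉ staysUpTo A (k + 1) := fun h'' => h' (h'' _ le_rfl)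
        rw [Set.indicator_of_notMem this, Set.indicator_of_mem h, hf _ h']
    · have : ω ∉ staysUpTo A (k + 1) := fun h' => h fun i hi => h' i (by omega)
      simp [h, this]
  simp only [hind]
  have hm1 : Measurable fun ω : ℕ → V =>
      (staysUpTo A k).indicator (fun ω => f (ω (k + 1))) ω :=
    (hfm.comp (measurable_pi_apply _)).indicator (measurableSet_staysUpTo A k)
  have hm2 : Measurable fun ω : ℕ → V => (staysUpTo A k).indicator (fun ω => ψ (ω k)) ω :=
    (hψm.comp (measurable_pi_apply _)).indicator (measurableSet_staysUpTo A k)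
  rw [walkLaw, ← Kernel.traj_comp_partialTraj (Nat.zero_le k),
    Kernel.lintegral_comp _ _ _ hm1, Kernel.lintegral_comp _ _ _ hm2]
  refine lintegral_congr fun h => ?_
  rw [Kernel.lintegral_traj h hm1, Kernel.lintegral_traj h hm2]
  have hupd : ∀ (ω : ℕ → V) i (hi : i ≤ k),
      Function.updateFinset ω (Finset.Iic k) h i = h ⟨i, Finset.mem_Iic.2 hi⟩ :=
    fun ω i hi => by simp [Function.updateFinset, hi]
  have hupd' : ∀ ω : ℕ → V, Function.updateFinset ω (Finset.Iic k) h (k + 1) = ω (k + 1) :=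
    fun ω => by simp [Function.updateFinset]
  by_cases hA : ∀ i (hi : i ≤ k), h ⟨i, Finset.mem_Iic.2 hi⟩ ∈ A
  · have hmem : ∀ ω : ℕ → V, Function.updateFinset ω (Finset.Iic k) h ∈ staysUpTo A k :=
      fun ω i hi => by rw [hupd ω i hi]; exact hA i hi
    simp only [Set.indicator_of_mem (hmem _), hupd', hupd _ k le_rfl, lintegral_const,
      measure_univ, mul_one]
    rw [← lintegral_map (μ := Kernel.traj (X := fun _ => V) Γ.historyKernel k h) hfm
        (measurable_pi_apply (k + 1)),
      ← Kernel.map_apply _ (measurable_pi_apply (k + 1)), Kernel.map_traj_succ_self]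
    exact lintegral_stepKernel _ f
  · have hmem : ∀ ω : ℕ → V, Function.updateFinset ω (Finset.Iic k) h ∉ staysUpTo A k :=
      fun ω hω => hA fun i hi => by simpa only [hupd ω i hi] using hω i hi
    simp only [Set.indicator_of_notMem (hmem _)]

theorem lintegral_staysUpTo_zero (A : Set V) (z : V) (f : V → ℝ≥0∞) (hf : ∀ y ∉ A, f y = 0) :
    ∫⁻ ω, (staysUpTo A 0).indicator (fun ω => f (ω 0)) ω ∂Γ.walkLaw z = f z := by
  have hfm : Measurable f := .of_discrete
  have hind : ∀ ω : ℕ → V, (staysUpTo A 0).indicator (fun ω => f (ω 0)) ω = f (ω 0) := by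
    intro ω
    by_cases h : ω 0 ∈ A
    · rw [Set.indicator_of_mem]
      intro i hi
      rwa [Nat.le_zero.1 hi]
    · simp [hf _ h]
  simp only [hind]
  have hm : Measurable fun ω : ℕ → V => f (ω 0) := hfm.comp (measurable_pi_apply 0)
  rw [walkLaw, Kernel.lintegral_traj _ hm]
  simp [Function.updateFinset]

/-- The mean exit time from a finite set is the solution of the Poisson equation with source `1`. -/
theorem meanExitFrom_eq [Countable V] [Infinite V] (hL : Γ.FiniteDegree) {U : Finset V} {e : V → ℝ}
    (he : Γ.IsPoisson U (fun _ => 1) e) (z : V) :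
    Γ.meanExitFrom z U = ENNReal.ofReal (e z) := by
  have he0 : ∀ y, 0 ≤ e y := he.nonneg hL fun _ _ => zero_le_one
  set E : V → ℝ≥0∞ := fun y => ENNReal.ofReal (e y) with hE
  have hEm : Measurable E := .of_discrete
  have hE0 : ∀ y ∉ (U : Set V), E y = 0 := fun y hy => by simp [hE, he.eq_zero y hy]
  set S : ℕ → ℝ≥0∞ := fun k =>
    ∫⁻ ω, (staysUpTo (U : Set V) k).indicator (fun ω => E (ω k)) ω ∂Γ.walkLaw z with hS
  set T : ℕ → ℝ≥0∞ := fun k =>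
    ∫⁻ ω, (staysUpTo (U : Set V) k).indicator (fun _ => 1) ω ∂Γ.walkLaw z with hT
  have hTm : ∀ k, Measurable fun ω : ℕ → V =>
      (staysUpTo (U : Set V) k).indicator (fun _ => (1 : ℝ≥0∞)) ω :=
    fun k => measurable_const.indicator (measurableSet_staysUpTo _ k)
  -- This is `e = 1 + P e` on `U` with the Markov property. Telescoping leaves the remainder `S N`,
  -- which tends to `0`: `e` is bounded, and the probabilities `T N` of staying in `U` up to time
  -- `N` are summable.
  have hstep : ∀ k, S k = T k + S (k + 1) := by
    intro k
    simp only [hS, hT]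
    rw [lintegral_staysUpTo_succ _ z k E hE0, ← lintegral_add_left (hTm k)]
    refine lintegral_congr fun ω => ?_
    by_cases h : ω ∈ staysUpTo (U : Set V) k
    · have hk : ω k ∈ U := h k le_rfl
      simp only [Set.indicator_of_mem h, hE]
      simp only [← ENNReal.ofReal_mul (trans_nonneg _ _)]
      rw [← ENNReal.ofReal_tsum_of_nonneg (fun y => mul_nonneg (trans_nonneg _ _) (he0 y))
        (hL.summable_trans_mul e _), ← ENNReal.ofReal_one, ← ENNReal.ofReal_add zero_le_one
        (tsum_nonneg fun y => mul_nonneg (trans_nonneg _ _) (he0 y))]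
      congr 1
      have := he.sub_markovOp _ hk
      simp only [markovOp] at this
      linarith
    · simp [h]
  have hsum : ∀ N, E z = ∑ k ∈ Finset.range N, T k + S N := by
    intro N
    induction N with
    | zero => simpa [hS] using (lintegral_staysUpTo_zero (Γ := Γ) (U : Set V) z E hE0).symm
    | succ N ih => rw [ih, Finset.sum_range_succ, hstep N, add_assoc]
  have hexit : Γ.meanExitFrom z U = ∑' k, T k := by
    rw [meanExitFrom, lintegral_congr fun ω => exitTime_eq_tsum (U : Set V) ω,
      lintegral_tsum fun k => (hTm k).aemeasurable]
  have hTle : ∑' k, T k ≤ E z := ENNReal.tsum_le_of_sum_range_le fun N => by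
    rw [hsum N]
    exact le_self_add
  have hTtop : ∑' k, T k ≠ ∞ := ne_top_of_le_ne_top ENNReal.ofReal_ne_top hTle
  have hT0 : Filter.Tendsto T Filter.atTop (nhds 0) :=
    ENNReal.tendsto_atTop_zero_of_tsum_ne_top hTtop
  obtain ⟨B, hB⟩ : ∃ B : ℝ, ∀ y, e y ≤ B := by
    obtain ⟨B, hB⟩ := (U.finite_toSet.image e).bddAbove
    refine ⟨max B 0, fun y => ?_⟩
    by_cases hy : y ∈ U
    · exact (hB ⟨y, hy, rfl⟩).trans (le_max_left _ _)
    · rw [he.eq_zero y hy]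
      exact le_max_right _ _
  have hST : ∀ N, S N ≤ ENNReal.ofReal B * T N := by
    intro N
    simp only [hS, hT]
    rw [← lintegral_const_mul _ (hTm N)]
    refine lintegral_mono fun ω => ?_
    by_cases h : ω ∈ staysUpTo (U : Set V) N
    · simpa [h, hE] using ENNReal.ofReal_le_ofReal (hB (ω N))
    · simp [h]
  have hS0 : Filter.Tendsto S Filter.atTop (nhds 0) := by
    have h1 : Filter.Tendsto (fun N => ENNReal.ofReal B * T N) Filter.atTop (nhds 0) := by
      simpa using ENNReal.Tendsto.const_mul hT0 (Or.inr ENNReal.ofReal_ne_top)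
    exact tendsto_of_tendsto_of_tendsto_of_le_of_le tendsto_const_nhds h1
      (fun _ => zero_le) hST
  rw [hexit]
  have h1 := (ENNReal.tendsto_nat_tsum T).add hS0
  simp only [← hsum, add_zero] at h1
  exact (tendsto_nhds_unique h1 tendsto_const_nhds)

end ExitTime

/-! ### The elliptic Harnack inequality for the Green kernel on spheres -/

/-- `K` is a common constant for the controlled weights and the Harnack inequality. -/
structure HarnackConst (Γ : WeightedGraph V) (K : ℝ) : Prop where
  one_le : 1 ≤ K
  one_le_mul_trans : ∀ x y : V, 0 < Γ.weight x y → 1 ≤ K * Γ.trans x y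
  harnack : ∀ (x : V) (R : ℝ), 0 < R → ∀ u : V → ℝ, (∀ y, 0 ≤ u y) →
    Γ.HarmonicOn u (Γ.ball x (2 * R)) → ∀ y ∈ Γ.ball x R, ∀ z ∈ Γ.ball x R, u y ≤ K * u z

theorem exists_harnackConst (hp : Γ.ControlledWeights) (hH : Γ.EllipticHarnack) :
    ∃ K, Γ.HarnackConst K := by
  obtain ⟨p, hp0, hp⟩ := hp
  obtain ⟨H, hH1, hH⟩ := hH
  refine ⟨max H p⁻¹, hH1.le.trans (le_max_left _ _), fun x y hxy => ?_, ?_⟩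
  · calc (1 : ℝ) = p⁻¹ * p := by field_simp
      _ ≤ max H p⁻¹ * Γ.trans x y :=
        mul_le_mul (le_max_right _ _) (hp x y hxy) hp0.le
          ((inv_nonneg.2 hp0.le).trans (le_max_right _ _))
  · intro x R hR u hu hharm y hy z hz
    exact (hH x R hR u (fun y _ => hu y) hharm y hy z hz).trans
      (mul_le_mul_of_nonneg_right (le_max_left _ _) (hu z))

/-- Superharmonicity gives `P(q',q) g(q) ≤ g(q')`, and controlled weights bound the transition
probability below. Being superharmonic suffices, so `q'` may be the pole. -/
theorem IsGreen.le_mul_of_dist_le_one [Infinite V] (hL : Γ.FiniteDegree) {K : ℝ}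
    (hK : Γ.HarnackConst K) {U : Finset V} {y : V} {g : V → ℝ} (hg : Γ.IsGreen U y g) {q q' : V}
    (hq' : q' ∈ U) (hd : Γ.graph.dist q' q ≤ 1) : g q ≤ K * g q' := by
  have h0 := hg.nonneg hL
  by_cases hqq : q' = q
  · subst hqq
    exact le_mul_of_one_le_left (h0 _) hK.one_le
  · have hadj : Γ.graph.Adj q' q := SimpleGraph.dist_eq_one_iff_adj.1
      (le_antisymm hd (Γ.graph_connected.pos_dist_of_ne hqq))
    have h1 := hK.one_le_mul_trans q' q (graph_adj.1 hadj).2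
    have h2 := (hL.trans_mul_le_markovOp h0 q' q).trans (hg.markovOp_le hq')
    calc g q ≤ K * Γ.trans q' q * g q := le_mul_of_one_le_left (h0 q) h1
      _ = K * (Γ.trans q' q * g q) := by ring
      _ ≤ K * g q' := mul_le_mul_of_nonneg_left h2 (zero_le_one.trans hK.one_le)

theorem IsGreen.le_mul_of_mem_ball [Infinite V] (hL : Γ.FiniteDegree) {K : ℝ}
    (hK : Γ.HarnackConst K) {U : Finset V} {y : V} {g : V → ℝ} (hg : Γ.IsGreen U y g) {w : V}
    {r : ℝ} (hr : 0 < r) (hU : ∀ z ∈ Γ.ball w (2 * r), z ∈ U) (hy : y ∉ Γ.ball w (2 * r))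
    {q q' : V} (hq : q ∈ Γ.ball w r) (hq' : q' ∈ Γ.ball w r) : g q ≤ K * g q' :=
  hK.harnack w r hr g (hg.nonneg hL)
    (fun z hz => hg.markovOp_eq (hU z hz) fun h => hy (h ▸ hz)) q hq q' hq'

theorem self_mem_ball (x : V) {r : ℝ} (hr : 0 < r) : x ∈ Γ.ball x r := by simpa [ball] using hr

/-- A Harnack chain along a geodesic from the centre of a sphere to a point that is far from the
pole `y`, another point of the sphere. -/
theorem IsGreen.harnack_chain [Infinite V] (hL : Γ.FiniteDegree) {K : ℝ}
    (hK : Γ.HarnackConst K) {U : Finset V} {x y y' : V} {k : ℕ} (hy : Γ.graph.dist x y = k)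
    (hy' : Γ.graph.dist x y' = k) (hyy' : k ≤ 2 * Γ.graph.dist y y')
    (hU : ∀ z, Γ.graph.dist x z ≤ 2 * k → z ∈ U) {g : V → ℝ} (hg : Γ.IsGreen U y g) :
    g x ≤ K ^ 16 * g y' ∧ g y' ≤ K ^ 16 * g x := by
  obtain ⟨p, hp0, hpk, hp⟩ := exists_geodesic Γ x y'
  rw [hy'] at hpk hp
  have hK0 : 0 ≤ K := zero_le_one.trans hK.one_le
  have hxp : ∀ j ≤ k, Γ.graph.dist x (p j) = j := fun j hj => by
    simpa [hp0] using hp 0 j (Nat.zero_le _) hj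
  -- The distance from `p j` to `y` is at least `k - j` and at least `d(y,y') - (k - j)`; the sum of
  -- these two bounds is `d(y,y') ≥ k/2`.
  have hfar : ∀ j ≤ k, k ≤ 4 * Γ.graph.dist (p j) y := by
    intro j hj
    have h1 := dist_triangle (Γ := Γ) x (p j) y
    have h2 := dist_triangle (Γ := Γ) y (p j) y'
    have h3 := hp j k hj le_rfl
    rw [hpk] at h3
    rw [hxp j hj, hy] at h1
    rw [SimpleGraph.dist_comm (u := y) (v := p j), h3] at h2
    omega
  -- Either a single edge, or a Harnack ball of radius `k/8` whose double misses the pole.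
  have hnear : ∀ i j, i ≤ k → j ≤ k → i ≤ j → (j - i ≤ 1 ∨ 8 * (j - i) < k) →
      g (p i) ≤ K * g (p j) ∧ g (p j) ≤ K * g (p i) := by
    intro i j hi hj hij h
    have hd := hp i j hij hj
    rcases h with h | h
    · refine ⟨hg.le_mul_of_dist_le_one hL hK (hU _ (by rw [hxp j hj]; omega)) ?_,
        hg.le_mul_of_dist_le_one hL hK (hU _ (by rw [hxp i hi]; omega)) (by omega)⟩
      rw [SimpleGraph.dist_comm]
      omega
    · have hr : (0 : ℝ) < k / 8 := by
        have : 0 < k := by omega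
        positivity
      have hUi : ∀ z ∈ Γ.ball (p i) (2 * (k / 8 : ℝ)), z ∈ U := by
        intro z hz
        rw [mem_ball] at hz
        have h1 : Γ.graph.dist (p i) z ≤ k := by
          have : (Γ.graph.dist (p i) z : ℝ) ≤ k := by linarith
          exact_mod_cast this
        have h2 := dist_triangle (Γ := Γ) x (p i) z
        rw [hxp i hi] at h2
        exact hU z (by omega)
      have hyi : y ∉ Γ.ball (p i) (2 * (k / 8 : ℝ)) := by
        rw [mem_ball, not_lt]
        have : (k : ℝ) ≤ 4 * Γ.graph.dist (p i) y := by exact_mod_cast hfar i hi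
        linarith
      have hj' : p j ∈ Γ.ball (p i) (k / 8 : ℝ) := by
        rw [mem_ball, hd, lt_div_iff₀ (by norm_num)]
        have : (j - i) * 8 < k := by omega
        exact_mod_cast this
      exact ⟨hg.le_mul_of_mem_ball hL hK hr hUi hyi (self_mem_ball _ hr) hj',
        hg.le_mul_of_mem_ball hL hK hr hUi hyi hj' (self_mem_ball _ hr)⟩
  -- With floor division a step has length at most `1` if `k ≤ 16`, and below `k/8` otherwise.
  have hchain : ∀ i ≤ 16, g x ≤ K ^ i * g (p (i * k / 16)) ∧
      g (p (i * k / 16)) ≤ K ^ i * g x := by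
    intro i
    induction i with
    | zero => simp [hp0]
    | succ i ih =>
      intro hi
      obtain ⟨h1, h2⟩ := ih (by omega)
      have hik : (i + 1) * k ≤ 16 * k := Nat.mul_le_mul_right k hi
      have hexp : (i + 1) * k = i * k + k := by ring
      obtain ⟨h3, h4⟩ := hnear (i * k / 16) ((i + 1) * k / 16)
        (by omega) (by omega) (by omega) (by omega)
      constructor
      · calc g x ≤ K ^ i * g (p (i * k / 16)) := h1
          _ ≤ K ^ i * (K * g (p ((i + 1) * k / 16))) := by gcongr
          _ = _ := by ring
      · calc g (p ((i + 1) * k / 16)) ≤ K * g (p (i * k / 16)) := h4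
          _ ≤ K * (K ^ i * g x) := by gcongr
          _ = _ := by ring
  have := hchain 16 le_rfl
  rwa [Nat.mul_div_cancel_left k (by norm_num), hpk] at this

/-- The Green kernel with pole at the centre is almost constant on spheres. -/
theorem green_le_mul_on_sphere [Infinite V] (hL : Γ.FiniteDegree) {K : ℝ}
    (hK : Γ.HarnackConst K) {U : Finset V} {x y y' : V} {k : ℕ} (hy : Γ.graph.dist x y = k)
    (hy' : Γ.graph.dist x y' = k) (hU : ∀ z, Γ.graph.dist x z ≤ 2 * k → z ∈ U) {g : V → ℝ}
    (hg : Γ.IsGreen U x g) : g y ≤ K ^ 32 * g y' := by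
  have h0 := hg.nonneg hL
  have hK0 : 0 ≤ K := zero_le_one.trans hK.one_le
  rcases Nat.eq_zero_or_pos k with rfl | hk
  · rw [Γ.graph_connected.dist_eq_zero_iff] at hy hy'
    subst hy hy'
    exact le_mul_of_one_le_left (h0 _) (one_le_pow₀ hK.one_le)
  -- Nearby points: the ball of radius `k` about `y` lies in `U` and misses `x`. Distant points: the
  -- pole moves from `x` to `y`, then to `y'`, by symmetry, with a chain of cost `K ^ 16` for each
  -- of these two poles.
  by_cases h : 2 * Γ.graph.dist y y' < k
  · have hr : (0 : ℝ) < k / 2 := by positivity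
    have h1 : g y ≤ K * g y' := by
      refine hg.le_mul_of_mem_ball hL hK (w := y) hr (fun z hz => ?_) ?_ (self_mem_ball _ hr) ?_
      · rw [mem_ball] at hz
        have h1 : Γ.graph.dist y z ≤ k := by
          have : (Γ.graph.dist y z : ℝ) ≤ k := by linarith
          exact_mod_cast this
        have h2 := dist_triangle (Γ := Γ) x y z
        exact hU z (by omega)
      · rw [mem_ball, SimpleGraph.dist_comm, hy]
        intro h
        linarith
      · rw [mem_ball, lt_div_iff₀ (by norm_num)]
        have : Γ.graph.dist y y' * 2 < k := by omega
        exact_mod_cast this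
    exact h1.trans (mul_le_mul_of_nonneg_right (le_self_pow₀ hK.one_le (by norm_num)) (h0 y'))
  · obtain ⟨g₁, hg₁⟩ := hL.exists_isPoisson U
      (open Classical in fun z => if z = y then (Γ.mass y)⁻¹ else 0)
    obtain ⟨g₂, hg₂⟩ := hL.exists_isPoisson U
      (open Classical in fun z => if z = y' then (Γ.mass y')⁻¹ else 0)
    have hxU : x ∈ U := hU x (by simp)
    have hyU : y ∈ U := hU y (by omega)
    have hyU' : y' ∈ U := hU y' (by omega)
    have e1 : g y = g₁ x := IsGreen.symm hg hg₁ hxU hyU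
    have e2 : g₁ y' = g₂ y := IsGreen.symm hg₁ hg₂ hyU hyU'
    have e3 : g y' = g₂ x := IsGreen.symm hg hg₂ hxU hyU'
    have c1 := (IsGreen.harnack_chain hL hK hy hy' (by omega) hU hg₁).1
    have c2 := (IsGreen.harnack_chain hL hK hy' hy
      (by rw [SimpleGraph.dist_comm]; omega) hU hg₂).2
    rw [e1, e3]
    calc g₁ x ≤ K ^ 16 * g₁ y' := c1
      _ = K ^ 16 * g₂ y := by rw [e2]
      _ ≤ K ^ 16 * (K ^ 16 * g₂ x) := by gcongr
      _ = _ := by ring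

theorem IsGreen.pole_pos [Infinite V] (hL : Γ.FiniteDegree) {U : Finset V} {x : V} {g : V → ℝ}
    (hg : Γ.IsGreen U x g) (hx : x ∈ U) : 0 < g x := by
  have h := hg.sub_markovOp x hx
  rw [if_pos rfl] at h
  have h1 : 0 ≤ Γ.markovOp g x :=
    tsum_nonneg fun y => mul_nonneg (trans_nonneg x y) (hg.nonneg hL y)
  linarith [inv_pos.2 (Γ.mass_pos x)]

/-- Positivity at the pole propagates along a geodesic, each edge costing at most a factor `K`. -/
theorem IsGreen.pos [Infinite V] (hL : Γ.FiniteDegree) {K : ℝ} (hK : Γ.HarnackConst K)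
    {U : Finset V} {x y : V} (hU : ∀ z, Γ.graph.dist x z ≤ Γ.graph.dist x y → z ∈ U) {g : V → ℝ}
    (hg : Γ.IsGreen U x g) : 0 < g y := by
  have hK0 : 0 < K := zero_lt_one.trans_le hK.one_le
  obtain ⟨p, hp0, hpk, hp⟩ := exists_geodesic Γ x y
  have h : ∀ j ≤ Γ.graph.dist x y, 0 < g (p j) := by
    intro j
    induction j with
    | zero =>
      intro _
      rw [hp0]
      exact hg.pole_pos hL (hU x (by simp))
    | succ j ih =>
      intro hj
      have h1 := hp 0 (j + 1) (Nat.zero_le _) hj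
      have h2 := hp j (j + 1) (Nat.le_succ j) hj
      rw [hp0] at h1
      rw [SimpleGraph.dist_comm] at h2
      have h3 := hg.le_mul_of_dist_le_one hL hK (hU (p (j + 1)) (by omega))
        (q := p j) (by omega)
      exact pos_of_mul_pos_right ((ih (by omega)).trans_le h3) hK0.le
  have := h _ le_rfl
  rwa [hpk] at this

/-! ### Maximum principles with boundary values on the neighbours only -/

theorem markovOp_congr {f g : V → ℝ} {x : V} (h : ∀ y, 0 < Γ.weight x y → f y = g y) :
    Γ.markovOp f x = Γ.markovOp g x := by
  refine tsum_congr fun y => ?_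
  by_cases hy : Γ.weight x y = 0
  · simp [trans, hy]
  · rw [h y (weight_pos_of_ne_zero hy)]

theorem FiniteDegree.le_of_subharmonic_of_boundary [Infinite V] (hL : Γ.FiniteDegree)
    (U : Finset V) {u : V → ℝ} {c : ℝ} (hsub : ∀ z ∈ U, u z ≤ Γ.markovOp u z)
    (hout : ∀ z ∉ U, ∀ w ∈ U, 0 < Γ.weight w z → u z ≤ c) {z : V} (hz : z ∈ U) : u z ≤ c := by
  classical
  -- Values beyond the neighbours of `U` do not enter `P u` on `U`, so they may be replaced by `c`.
  set u' : V → ℝ := fun z => if z ∈ U ∨ ∃ w ∈ U, 0 < Γ.weight w z then u z else c with hu'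
  have hin : ∀ z ∈ U, u' z = u z := fun z hz => if_pos (Or.inl hz)
  have h := hL.le_of_subharmonic U (u := u') (c := c) (fun z hz => ?_) (fun z hz => ?_) z
  · rwa [hin z hz] at h
  · rw [hin z hz, markovOp_congr (g := u) fun y hy => if_pos (Or.inr ⟨z, hz, hy⟩)]
    exact hsub z hz
  · simp only [hu']
    split_ifs with h
    · obtain ⟨w, hw, hwz⟩ := h.resolve_left hz
      exact hout z hz w hw hwz
    · exact le_rfl

theorem FiniteDegree.le_of_superharmonic_of_boundary [Infinite V] (hL : Γ.FiniteDegree)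
    (U : Finset V) {u : V → ℝ} {c : ℝ} (hsup : ∀ z ∈ U, Γ.markovOp u z ≤ u z)
    (hout : ∀ z ∉ U, ∀ w ∈ U, 0 < Γ.weight w z → c ≤ u z) {z : V} (hz : z ∈ U) : c ≤ u z := by
  have := hL.le_of_subharmonic_of_boundary U (u := fun z => -1 * u z) (c := -c)
    (fun z hz => by rw [markovOp_smul]; linarith [hsup z hz])
    (fun z hz w hw hwz => by linarith [hout z hz w hw hwz]) hz
  linarith

/-- The Green kernel decreases away from the pole, up to its oscillation on spheres. -/
theorem IsGreen.le_of_le_dist [Infinite V] (hL : Γ.FiniteDegree) {U : Finset V} {x : V}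
    {g : V → ℝ} (hg : Γ.IsGreen U x g) {k : ℕ} {M : ℝ} (hM0 : 0 ≤ M)
    (hM : ∀ z, Γ.graph.dist x z = k → g z ≤ M) {z : V} (hz : k ≤ Γ.graph.dist x z) : g z ≤ M := by
  classical
  rcases hz.eq_or_lt with hz | hz
  · exact hM z hz.symm
  by_cases hzU : z ∈ U
  · refine hL.le_of_subharmonic_of_boundary (U.filter fun z => k < Γ.graph.dist x z) (u := g)
      (fun w hw => ?_) (fun w hw v hv hvw => ?_) (Finset.mem_filter.2 ⟨hzU, hz⟩)
    · rw [Finset.mem_filter] at hw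
      refine (hg.markovOp_eq hw.1 ?_).ge
      rintro rfl
      simp at hw
    · rw [Finset.mem_filter] at hw hv
      by_cases hwU : w ∈ U
      · have h1 : ¬ k < Γ.graph.dist x w := fun h => hw ⟨hwU, h⟩
        have h2 := dist_le_succ_of_weight_pos x (Γ.weight_symm v w ▸ hvw)
        exact hM w (by omega)
      · rw [hg.eq_zero w hwU]
        exact hM0
  · rw [hg.eq_zero z hzU]
    exact hM0

/-- The minimum principle needs only superharmonicity, so the pole inside the ball is harmless. -/
theorem IsGreen.le_of_dist_le [Infinite V] (hL : Γ.FiniteDegree) {U : Finset V} {x : V}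
    {g : V → ℝ} (hg : Γ.IsGreen U x g) {k : ℕ} (hU : ∀ z, Γ.graph.dist x z ≤ k → z ∈ U) {m : ℝ}
    (hm : ∀ z, Γ.graph.dist x z = k → m ≤ g z) {z : V} (hz : Γ.graph.dist x z ≤ k) : m ≤ g z := by
  classical
  rcases hz.eq_or_lt with hz' | hz'
  · exact hm z hz'
  refine hL.le_of_superharmonic_of_boundary (U.filter fun z => Γ.graph.dist x z < k) (u := g)
    (fun w hw => hg.markovOp_le (Finset.mem_filter.1 hw).1) (fun w hw v hv hvw => ?_)
    (Finset.mem_filter.2 ⟨hU z hz, hz'⟩)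
  rw [Finset.mem_filter] at hw hv
  have h2 := dist_le_succ_of_weight_pos x hvw
  have h1 : ¬ Γ.graph.dist x w < k := fun h => hw ⟨hU w h.le, h⟩
  exact hm w (by omega)

/-! ### Exit times and volumes of balls -/

/-- The ball as a finset. -/
noncomputable def FiniteDegree.ballFinset (hL : Γ.FiniteDegree) (x : V) (R : ℝ) : Finset V :=
  (hL.finite_ball x R).toFinset

theorem FiniteDegree.mem_ballFinset (hL : Γ.FiniteDegree) {x y : V} {R : ℝ} :
    y ∈ hL.ballFinset x R ↔ (Γ.graph.dist x y : ℝ) < R := by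
  simp [ballFinset, mem_ball]

theorem FiniteDegree.coe_ballFinset (hL : Γ.FiniteDegree) (x : V) (R : ℝ) :
    (hL.ballFinset x R : Set V) = Γ.ball x R := by simp [ballFinset]

theorem FiniteDegree.vol_eq_sum (hL : Γ.FiniteDegree) (x : V) (R : ℝ) :
    Γ.vol x R = ∑ y ∈ hL.ballFinset x R, Γ.mass y := by
  rw [vol, ← hL.coe_ballFinset]
  exact Finset.tsum_subtype _ _

theorem mass_nonneg (x : V) : 0 ≤ Γ.mass x := tsum_nonneg (Γ.weight_nonneg x)

theorem FiniteDegree.vol_nonneg (hL : Γ.FiniteDegree) (x : V) (R : ℝ) : 0 ≤ Γ.vol x R := by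
  rw [hL.vol_eq_sum]
  exact Finset.sum_nonneg fun y _ => mass_nonneg y

theorem FiniteDegree.vol_mono (hL : Γ.FiniteDegree) {x y : V} {r R : ℝ}
    (h : ∀ z, (Γ.graph.dist x z : ℝ) < r → (Γ.graph.dist y z : ℝ) < R) :
    Γ.vol x r ≤ Γ.vol y R := by
  rw [hL.vol_eq_sum, hL.vol_eq_sum]
  exact Finset.sum_le_sum_of_subset_of_nonneg
    (fun z hz => hL.mem_ballFinset.2 (h z (hL.mem_ballFinset.1 hz))) fun z _ _ => mass_nonneg z

theorem real_dist_triangle (x y z : V) :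
    (Γ.graph.dist x z : ℝ) ≤ Γ.graph.dist x y + Γ.graph.dist y z := by
  exact_mod_cast dist_triangle x y z

/-- Under volume doubling an annulus carries a fixed part of the volume of the ball. -/
theorem FiniteDegree.vol_le_annulusVol [Infinite V] (hL : Γ.FiniteDegree) {D : ℝ} (hD : 0 < D)
    (hV : ∀ (x : V) (R : ℝ), 0 < R → Γ.vol x (2 * R) ≤ D * Γ.vol x R) (x : V) {R : ℝ}
    (hR : 1 / 2 < R) : Γ.vol x (2 * R) ≤ D ^ 4 * Γ.annulusVol x R (2 * R) := by
  classical
  -- A ball of radius `R/4` inside the annulus. For `R < 2` it is a single vertex, at distance `⌈R⌉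
  -- < 2R` because `R > 1/2`. For `R ≥ 2` its centre has distance `⌈5R/4⌉`, and `5R/4 + 1 + R/4 ≤
  -- 2R`.
  obtain ⟨y, hyR, hy⟩ : ∃ y, (Γ.graph.dist x y : ℝ) < 2 * R ∧
      ∀ z, (Γ.graph.dist y z : ℝ) < R / 4 →
        R ≤ Γ.graph.dist x z ∧ (Γ.graph.dist x z : ℝ) < 2 * R := by
    by_cases h2 : R < 2
    · obtain ⟨y, hy⟩ := hL.exists_dist_eq x ⌈R⌉₊
      have h1 : R ≤ Γ.graph.dist x y := by rw [hy]; exact Nat.le_ceil R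
      have h3 : (Γ.graph.dist x y : ℝ) < 2 * R := by
        rw [hy]
        rcases le_total R 1 with h | h
        · have : ⌈R⌉₊ ≤ 1 := Nat.ceil_le.2 (by simpa using h)
          have : (⌈R⌉₊ : ℝ) ≤ 1 := by exact_mod_cast this
          linarith
        · linarith [Nat.ceil_lt_add_one (a := R) (by linarith)]
      refine ⟨y, h3, fun z hz => ?_⟩
      have h4 : (Γ.graph.dist y z : ℝ) < 1 := by linarith
      have h5 : Γ.graph.dist y z = 0 := by
        have : Γ.graph.dist y z < 1 := by exact_mod_cast h4
        omega
      rw [← Γ.graph_connected.dist_eq_zero_iff.1 h5]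
      exact ⟨h1, h3⟩
    · obtain ⟨y, hy⟩ := hL.exists_dist_eq x ⌈5 * R / 4⌉₊
      have h1 := Nat.le_ceil (5 * R / 4)
      have h3 := Nat.ceil_lt_add_one (a := 5 * R / 4) (by linarith)
      rw [← hy] at h1 h3
      refine ⟨y, by linarith, fun z hz => ?_⟩
      have h4 := real_dist_triangle (Γ := Γ) x y z
      have h5 := real_dist_triangle (Γ := Γ) x z y
      rw [SimpleGraph.dist_comm (u := z)] at h5
      constructor <;> linarith
  have hann : Γ.vol y (R / 4) ≤ Γ.annulusVol x R (2 * R) := by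
    rw [annulusVol, hL.vol_eq_sum x R, hL.vol_eq_sum x (2 * R), hL.vol_eq_sum y,
      ← Finset.sum_sdiff_eq_sub fun z hz =>
        hL.mem_ballFinset.2 (by have := hL.mem_ballFinset.1 hz; linarith)]
    refine Finset.sum_le_sum_of_subset_of_nonneg (fun z hz => ?_) fun z _ _ => mass_nonneg z
    have h := hy z (hL.mem_ballFinset.1 hz)
    rw [Finset.mem_sdiff, hL.mem_ballFinset, hL.mem_ballFinset, not_lt]
    exact ⟨h.2, h.1⟩
  have hbig : Γ.vol x (2 * R) ≤ Γ.vol y (4 * R) := hL.vol_mono fun z hz => by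
    have h4 := real_dist_triangle (Γ := Γ) y x z
    rw [SimpleGraph.dist_comm (u := y) (v := x)] at h4
    linarith
  have hdouble : ∀ j : ℕ, Γ.vol y (2 ^ j * (R / 4)) ≤ D ^ j * Γ.vol y (R / 4) := by
    intro j
    induction j with
    | zero => simp
    | succ j ih =>
      calc Γ.vol y (2 ^ (j + 1) * (R / 4)) = Γ.vol y (2 * (2 ^ j * (R / 4))) := by ring_nf
        _ ≤ D * Γ.vol y (2 ^ j * (R / 4)) := hV y _ (by positivity)
        _ ≤ D * (D ^ j * Γ.vol y (R / 4)) := by gcongr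
        _ = _ := by ring
  calc Γ.vol x (2 * R) ≤ Γ.vol y (4 * R) := hbig
    _ = Γ.vol y (2 ^ 4 * (R / 4)) := by ring_nf
    _ ≤ D ^ 4 * Γ.vol y (R / 4) := hdouble 4
    _ ≤ _ := by gcongr

theorem FiniteDegree.meanExit_eq [Infinite V] [Countable V] [MeasurableSpace V]
    [DiscreteMeasurableSpace V] (hL : Γ.FiniteDegree) (x : V) {R : ℝ} {e : V → ℝ}
    (he : Γ.IsPoisson (hL.ballFinset x R) (fun _ => 1) e) :
    Γ.meanExit x R = ENNReal.ofReal (e x) := by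
  rw [meanExit, ← hL.coe_ballFinset]
  exact meanExitFrom_eq hL he x

/-- The mean exit time from `U` is at most the one from a smaller ball, plus the volume of `U` times
a bound of the Green kernel outside that ball. -/
theorem IsPoisson.le_add_mul_sum_mass [Infinite V] (hL : Γ.FiniteDegree) {U W : Finset V}
    {x : V} {g e e' : V → ℝ} (hg : Γ.IsGreen U x g) (he : Γ.IsPoisson U (fun _ => 1) e)
    (he' : Γ.IsPoisson W (fun _ => 1) e') (hWU : W ⊆ U) (hx : x ∈ U) {M : ℝ}
    (hxW : x ∉ W → ∀ z, g z ≤ M) (hM : ∀ z ∉ W, g z ≤ M) :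
    e x ≤ e' x + M * ∑ z ∈ U, Γ.mass z := by
  by_cases hxW' : x ∈ W
  · obtain ⟨h, hh⟩ := hL.exists_isPoisson W
      (open Classical in fun z => if z = x then (Γ.mass x)⁻¹ else 0)
    -- In `W` the poles of `g` and `h` cancel, so `g - h` is harmonic there and bounded by its
    -- values outside.
    have hgh : ∀ z, g z ≤ h z + M := by
      intro z
      have := hL.le_of_subharmonic W (u := fun z => g z - h z) (c := M)
        (fun z hz => by
          rw [hL.markovOp_sub]
          linarith [hh.sub_markovOp z hz, hg.sub_markovOp z (hWU hz)])
        (fun z hz => by simpa [hh.eq_zero z hz] using hM z hz) z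
      linarith
    rw [← IsGreen.sum_mul_mass hg he hx, ← IsGreen.sum_mul_mass hh he' hxW']
    rw [Finset.sum_subset hWU fun z _ hz => by rw [hh.eq_zero z hz, zero_mul], Finset.mul_sum,
      ← Finset.sum_add_distrib]
    refine Finset.sum_le_sum fun z _ => ?_
    rw [← add_mul]
    exact mul_le_mul_of_nonneg_right (hgh z) (mass_nonneg z)
  · rw [he'.eq_zero x hxW', zero_add, ← IsGreen.sum_mul_mass hg he hx, Finset.mul_sum]
    exact Finset.sum_le_sum fun z _ => mul_le_mul_of_nonneg_right (hxW hxW' z) (mass_nonneg z)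

/-- If the mean exit times from `U` started on the boundary of `W` are at least `c`, then so is the
gain of the mean exit time between `W` and `U`. -/
theorem IsPoisson.add_le_of_boundary [Infinite V] (hL : Γ.FiniteDegree) {U W : Finset V}
    {x : V} {e e' : V → ℝ} (he : Γ.IsPoisson U (fun _ => 1) e)
    (he' : Γ.IsPoisson W (fun _ => 1) e') (hWU : W ⊆ U) (hx : x ∈ W) {c : ℝ}
    (hc : ∀ z ∉ W, ∀ w ∈ W, 0 < Γ.weight w z → c ≤ e z) : e' x + c ≤ e x := by
  have := hL.le_of_superharmonic_of_boundary W (u := fun z => e z - e' z) (c := c)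
    (fun z hz => by
      rw [hL.markovOp_sub]
      linarith [he'.sub_markovOp z hz, he.sub_markovOp z (hWU hz)])
    (fun z hz w hw hwz => by
      rw [he'.eq_zero z hz, sub_zero]
      exact hc z hz w hw hwz) hx
  linarith

/-- Comparison of the mean exit times from two concentric balls, under the weak time comparison. -/
theorem FiniteDegree.exit_le_mul_sub [Infinite V] [Countable V] [MeasurableSpace V]
    [DiscreteMeasurableSpace V] (hL : Γ.FiniteDegree) {C : ℝ} (hC : 0 < C)
    (hT : ∀ (x : V) (R : ℝ), 0 < R → ∀ y ∈ Γ.ball x R,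
      Γ.meanExit x R ≤ ENNReal.ofReal C * Γ.meanExit y R)
    {U : Finset V} {x : V} {k : ℕ} (hU : ∀ z, Γ.graph.dist x z ≤ 2 * k → z ∈ U) {e e' : V → ℝ}
    (he : Γ.IsPoisson U (fun _ => 1) e)
    (he' : Γ.IsPoisson (hL.ballFinset x k) (fun _ => 1) e') :
    e' x ≤ C * (e x - e' x) := by
  have he0 : ∀ z, 0 ≤ e z := he.nonneg hL fun _ _ => zero_le_one
  have hmem : ∀ z, z ∈ hL.ballFinset x k ↔ Γ.graph.dist x z < k := fun z => by
    rw [hL.mem_ballFinset, Nat.cast_lt]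
  -- The radius is `k + 1` because balls are open: `y` must lie in the ball about `x` for the time
  -- comparison, while the ball about `y` is `{d(y,·) ≤ k}` and still fits into `U`.
  have hbd : ∀ y, Γ.graph.dist x y = k → e' x ≤ C * e y := by
    intro y hy
    obtain ⟨e₁, he₁⟩ := hL.exists_isPoisson (hL.ballFinset x (k + 1)) (fun _ => 1)
    obtain ⟨e₂, he₂⟩ := hL.exists_isPoisson (hL.ballFinset y (k + 1)) (fun _ => 1)
    have h1 : e' x ≤ e₁ x := he'.mono hL he₁ (fun z hz => by
      have := hL.mem_ballFinset.1 hz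
      exact hL.mem_ballFinset.2 (by linarith)) (fun _ _ => zero_le_one) x
    have h2 : e₂ y ≤ e y := he₂.mono hL he (fun z hz => by
      have h3 := hL.mem_ballFinset.1 hz
      have h4 : Γ.graph.dist y z < k + 1 := by exact_mod_cast h3
      have h5 := dist_triangle (Γ := Γ) x y z
      exact hU z (by omega)) (fun _ _ => zero_le_one) y
    have h3 := hT x (k + 1) (by positivity) y (by rw [mem_ball, hy]; linarith)
    rw [hL.meanExit_eq x he₁, hL.meanExit_eq y he₂, ← ENNReal.ofReal_mul hC.le,
      ENNReal.ofReal_le_ofReal_iff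
        (mul_nonneg hC.le (he₂.nonneg hL (fun _ _ => zero_le_one) y))] at h3
    exact h1.trans (h3.trans (by gcongr))
  by_cases hx : x ∈ hL.ballFinset x k
  · have h := IsPoisson.add_le_of_boundary hL he he' (c := C⁻¹ * e' x)
      (fun z hz => hU z (by have := (hmem z).1 hz; omega)) hx (fun z hz w hw hwz => by
        rw [hmem] at hz hw
        have h1 := dist_le_succ_of_weight_pos x hwz
        rw [inv_mul_le_iff₀ hC]
        exact hbd z (by omega))
    rw [← inv_mul_le_iff₀ hC]
    linarith
  · rw [he'.eq_zero x hx, sub_zero]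
    exact mul_nonneg hC.le (he0 x)

end WeightedGraph

/-! ### Comparison of resistance and exit time through the Green kernel on one sphere -/

open WeightedGraph in
theorem mainTheorem2 {V : Type*} [Countable V] [Infinite V]
    [MeasurableSpace V] [DiscreteMeasurableSpace V] (Γ : WeightedGraph V)
    (hp : Γ.ControlledWeights) (hV : Γ.VolumeDoubling) (hH : Γ.EllipticHarnack)
    (hT : Γ.WeakTimeComparison) :
    ∃ C : ℝ, 1 < C ∧ ∀ (x : V) (R : ℝ), 1 / 2 < R →
      ENNReal.ofReal (C⁻¹ * (Γ.annulusRes x R (2 * R) * Γ.annulusVol x R (2 * R))) ≤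
          Γ.meanExit x (2 * R) ∧
        Γ.meanExit x (2 * R) ≤
          ENNReal.ofReal (C * (Γ.annulusRes x R (2 * R) * Γ.annulusVol x R (2 * R))) := by
  have hL := hp.finiteDegree
  obtain ⟨K, hK⟩ := exists_harnackConst hp hH
  obtain ⟨D, hD, hV⟩ := hV
  obtain ⟨C, hC, hT⟩ := hT
  have hK0 : 0 < K := zero_lt_one.trans_le hK.one_le
  set c : ℝ := K ^ 32 with hc
  have hc0 : 0 < c := by positivity
  refine ⟨1 + c ^ 2 * D + (C + 1) * c ^ 2 * D ^ 4, ?_, fun x R hR => ?_⟩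
  · have h1 : 0 < c ^ 2 * D := by positivity
    have h2 : 0 < (C + 1) * c ^ 2 * D ^ 4 := by positivity
    linarith
  -- `k` is the largest integer below `R`: the sphere of radius `k` is the outermost one in
  -- `B(x,R)`, and `2k < 2R` keeps the closed ball of radius `2k` in `U`.
  obtain ⟨k, hk⟩ : ∃ k, ⌈R⌉₊ = k + 1 :=
    Nat.exists_eq_succ_of_ne_zero (Nat.ceil_pos.2 (by linarith)).ne'
  have hkR : (k : ℝ) < R := Nat.lt_ceil.1 (by omega)
  have hA : ∀ z, z ∈ Γ.ball x R ↔ Γ.graph.dist x z ≤ k := fun z => by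
    rw [mem_ball_iff_lt_ceil, hk, Nat.lt_succ_iff]
  set U := hL.ballFinset x (2 * R) with hUdef
  have hU : ∀ z, Γ.graph.dist x z ≤ 2 * k → z ∈ U := fun z hz => by
    have : (Γ.graph.dist x z : ℝ) ≤ 2 * k := by exact_mod_cast hz
    exact hL.mem_ballFinset.2 (by linarith)
  have hxU : x ∈ U := hU x (by simp)
  obtain ⟨g, hg'⟩ := hL.exists_isPoisson U
    (open Classical in fun z => if z = x then (Γ.mass x)⁻¹ else 0)
  have hg : Γ.IsGreen U x g := hg'
  obtain ⟨e, he⟩ := hL.exists_isPoisson U (fun _ => 1)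
  -- The radius is `k` rather than `R`, so that the sphere of radius `k`, where `g` is controlled,
  -- lies outside. For `k = 0` this ball is empty and `e' x = 0`.
  obtain ⟨e', he'⟩ := hL.exists_isPoisson (hL.ballFinset x k) (fun _ => 1)
  obtain ⟨y, hy⟩ := hL.exists_dist_eq x k
  have ha : 0 < g y := hg.pos hL hK fun z hz => hU z (by omega)
  have hupper : ∀ z, k ≤ Γ.graph.dist x z → g z ≤ c * g y := fun z hz =>
    hg.le_of_le_dist hL (by positivity) (fun w hw => green_le_mul_on_sphere hL hK hw hy hU hg) hz
  have hlower : ∀ z, Γ.graph.dist x z ≤ k → c⁻¹ * g y ≤ g z := fun z hz =>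
    hg.le_of_dist_le hL (fun w hw => hU w (by omega)) (fun w hw => by
      rw [inv_mul_le_iff₀ hc0]
      exact green_le_mul_on_sphere hL hK hy hw hU hg) hz
  have hρ : Γ.annulusRes x R (2 * R) ∈ Set.Icc (c⁻¹ * g y) (c * g y) := by
    rw [annulusRes, ← hL.coe_ballFinset x (2 * R)]
    refine hg.resistance_mem_Icc hL ((hA x).2 (by simp))
      (fun z hz => hU z (by have := (hA z).1 hz; omega)) (by positivity)
      (fun z hz => hlower z ((hA z).1 hz)) (by positivity) fun z hz => ?_
    have hz' : Γ.graph.dist x z < k := by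
      by_contra! h
      exact (hupper z h).not_gt hz
    refine ⟨(hA z).2 hz'.le, fun w hw => (hA w).2 ?_⟩
    have := dist_le_succ_of_weight_pos x hw
    omega
  rw [hL.meanExit_eq x he]
  set ρ := Γ.annulusRes x R (2 * R)
  set v := Γ.annulusVol x R (2 * R) with hv
  have hρ0 : 0 ≤ ρ := le_trans (by positivity) hρ.1
  have hvol := hL.vol_le_annulusVol hD hV x hR
  rw [← hv] at hvol
  have hv0 : 0 ≤ v := nonneg_of_mul_nonneg_right ((hL.vol_nonneg x _).trans hvol) (by positivity)
  have hvle : v ≤ D * Γ.vol x R :=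
    (sub_le_self _ (hL.vol_nonneg x R)).trans (hV x R (by linarith))
  have he0 : 0 ≤ e x := he.nonneg hL (fun _ _ => zero_le_one) x
  have hlow : ρ * v ≤ c ^ 2 * D * e x := by
    have h1 : c⁻¹ * g y * Γ.vol x R ≤ e x := by
      rw [← hg.sum_mul_mass he hxU, hL.vol_eq_sum, Finset.mul_sum]
      refine (Finset.sum_le_sum fun z hz => ?_).trans
        (Finset.sum_le_sum_of_subset_of_nonneg (s := hL.ballFinset x R) (fun z hz => ?_)
          fun z _ _ => mul_nonneg (hg.nonneg hL z) (mass_nonneg z))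
      · refine mul_le_mul_of_nonneg_right (hlower z ((hA z).1 ?_)) (mass_nonneg z)
        exact hL.mem_ballFinset.1 hz
      · have := hL.mem_ballFinset.1 hz
        exact hL.mem_ballFinset.2 (by linarith)
    calc ρ * v ≤ c * g y * (D * Γ.vol x R) := mul_le_mul hρ.2 hvle hv0 (by positivity)
      _ = c ^ 2 * D * (c⁻¹ * g y * Γ.vol x R) := by field_simp
      _ ≤ c ^ 2 * D * e x := by gcongr
  have hup : e x ≤ (C + 1) * c ^ 2 * D ^ 4 * (ρ * v) := by
    have h1 : e x ≤ e' x + c * g y * Γ.vol x (2 * R) := by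
      rw [hL.vol_eq_sum]
      refine IsPoisson.le_add_mul_sum_mass hL hg he he' (fun z hz => ?_) hxU (fun hx z => ?_)
        fun z hz => ?_
      · have := hL.mem_ballFinset.1 hz
        exact hL.mem_ballFinset.2 (by linarith)
      · have hk0 : k = 0 := by
          simpa [hL.mem_ballFinset] using hx
        exact hupper z (by omega)
      · rw [hL.mem_ballFinset, Nat.cast_lt, not_lt] at hz
        exact hupper z hz
    have h2 := hL.exit_le_mul_sub hC hT hU he he'
    -- Here `e x = e' x + (e x - e' x) ≤ (C + 1) (e x - e' x)`.
    have h3 : e x ≤ (C + 1) * (c * g y * Γ.vol x (2 * R)) := by nlinarith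
    have h4 : c * g y ≤ c ^ 2 * ρ := by
      calc c * g y = c ^ 2 * (c⁻¹ * g y) := by field_simp
        _ ≤ c ^ 2 * ρ := by gcongr; exact hρ.1
    calc e x ≤ (C + 1) * (c * g y * Γ.vol x (2 * R)) := h3
      _ ≤ (C + 1) * (c ^ 2 * ρ * (D ^ 4 * v)) := by
        gcongr
        exact hL.vol_nonneg x _
      _ = _ := by ring
  have hρv : 0 ≤ ρ * v := mul_nonneg hρ0 hv0
  have hc1 : 0 ≤ c ^ 2 * D := by positivity
  have hc2 : 0 ≤ (C + 1) * c ^ 2 * D ^ 4 := by positivity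
  refine ⟨ENNReal.ofReal_le_ofReal ?_, ENNReal.ofReal_le_ofReal ?_⟩
  · rw [inv_mul_le_iff₀ (by positivity)]
    nlinarith [mul_nonneg hc2 he0]
  · nlinarith [mul_nonneg hc1 hρv]
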